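/- For a convex polygon $P$ with interior angles $\theta_1,\dots,\theta_n\in(0,\pi)$, $n\ge 3$, let $|P|$ be its area and $S(P)=\sum_{k=1}^n\frac{\pi^2-\theta_k^2}{\theta_k}$. A convex polygon $P$ of unit perimeter is called a maximizer if $|Q|\le|P|$ for every convex polygon $Q$ (with any number of sides) of unit perimeter with $S(Q)=S(P)$. Then: (i) A convex $n$-sided polygon of unit perimeter is a maximizer if and only if it is circumscriptible (all its sides are tangent to one circle) and all its angles are equal except possibly one, which is then larger than the rest. (ii) If $P$ and $Q$ are two non-congruent convex polygons of unit perimeter, possibly with different numbers of sides, each of which is circumscriptible with all angles equal except possibly one larger angle, then $S(P)\neq S(Q)$. -/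

import Mathlib

noncomputable section

/-- The Euclidean plane. -/
abbrev Plane : Type := EuclideanSpace ℝ (Fin 2)

/-- The cross product (signed area of the parallelogram) of two plane vectors. -/
def planeCross (u w : Plane) : ℝ := u 0 * w 1 - u 1 * w 0

/-- A convex polygon with `n ≥ 3` sides: its `n` vertices, listed counterclockwise around the
boundary. For every side, all the vertices other than its two endpoints lie strictly to the left
of it. In particular the vertices are distinct and every interior angle lies in `(0, π)`, so that
`n` is the actual number of sides. -/
structure ConvexPolygon (n : ℕ) extends Polygon Plane n where
  three_le : 3 ≤ n
  convex : ∀ i k : Fin n, k ≠ i → k ≠ finRotate n i →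
    0 < planeCross (vertices (finRotate n i) - vertices i) (vertices k - vertices i)

namespace ConvexPolygon

variable {n m : ℕ}

/-- The closed plane region bounded by the polygon. -/
def region (P : ConvexPolygon n) : Set Plane := convexHull ℝ (Set.range P.vertices)

/-- The area: Lebesgue measure of the region. -/
def area (P : ConvexPolygon n) : ℝ := MeasureTheory.volume.real P.region

/-- The perimeter: the sum of the lengths of the sides. -/
def perimeter (P : ConvexPolygon n) : ℝ :=
  ∑ i, dist (P.vertices i) (P.vertices (finRotate n i))

/-- The interior angle at the `i`-th vertex. -/
def interiorAngle (P : ConvexPolygon n) (i : Fin n) : ℝ :=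
  EuclideanGeometry.angle (P.vertices ((finRotate n).symm i)) (P.vertices i)
    (P.vertices (finRotate n i))

/-- The sum `S(P) = ∑ (π² - θₖ²) / θₖ` over the interior angles `θₖ`. -/
def angleSum (P : ConvexPolygon n) : ℝ :=
  ∑ k, (Real.pi ^ 2 - P.interiorAngle k ^ 2) / P.interiorAngle k

/-- `P` is circumscriptible: some circle is tangent to all its sides
(each tangency point lies on the side itself). -/
def IsCircumscriptible (P : ConvexPolygon n) : Prop :=
  ∃ c : EuclideanGeometry.Sphere Plane, 0 < c.radius ∧
    ∀ i, ∃ p ∈ segment ℝ (P.vertices i) (P.vertices (finRotate n i)),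
      c.IsTangentAt p (affineSpan ℝ {P.vertices i, P.vertices (finRotate n i)})

/-- All angles are equal, except that possibly one of them is larger than the rest. -/
def AnglesEqualButOneLarger (P : ConvexPolygon n) : Prop :=
  ∃ (j : Fin n) (α : ℝ), (∀ i, i ≠ j → P.interiorAngle i = α) ∧ α ≤ P.interiorAngle j

/-- Semi-regular polygons. -/
def IsSemiRegular (P : ConvexPolygon n) : Prop :=
  P.IsCircumscriptible ∧ P.AnglesEqualButOneLarger

/-- `P` has unit perimeter, and has the largest area among all convex polygons, with any number of
sides, that have unit perimeter and the same value of `S`. -/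
def IsMaximizer (P : ConvexPolygon n) : Prop :=
  P.perimeter = 1 ∧ ∀ (k : ℕ) (Q : ConvexPolygon k),
    Q.perimeter = 1 → Q.angleSum = P.angleSum → Q.area ≤ P.area

/-- Two polygons are congruent: an isometry of the plane takes one region onto the other. -/
def IsCongruent (P : ConvexPolygon n) (Q : ConvexPolygon m) : Prop :=
  ∃ e : Plane ≃ᵢ Plane, e '' P.region = Q.region

end ConvexPolygon

end

/-! # Maximal area among convex polygons with prescribed perimeter and angle sum `S` -/

noncomputable section

open Real Set MeasureTheory

/-! ### The angle optimisation problem -/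

/-! Write C for the sum of cot(θ/2) over the interior angles. L'Huilier's inequality gives 4 |P| C ≤
1 at unit perimeter, with equality exactly for circumscriptible polygons
(`ConvexPolygon.four_mul_area_mul_le`, `ConvexPolygon.four_mul_area_mul_eq`). Every admissible
family of angles belongs to some circumscriptible polygon (`ConvexPolygon.exists_circumscriptible`).
So the maximizers are the circumscriptible polygons whose angles minimise C for the given S.

The number of sides is free, but an angle π contributes nothing to Σ(π - θ), to S or to C. One can
therefore fix the number of angles, let them range over (0, π], obtain a minimiser by compactness,
and discard the angles π at the end. As S = Σ(π²/θ - θ), fixing S and Σθ fixes Σ1/θ. If a < b ≤ c <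
π are three of the angles, they can be moved with both sums kept, a and c growing and b shrinking,
and C drops because the third derivative of t cot(t/2) is negative (`exists_better_triple`). Hence
the angles below π of a minimiser are equal, except possibly one larger.

Such a family is determined by S (`equalButOneLarger_unique`): in terms of exterior angles u, S = π
Σ u/(π - u) + 2π with a strictly convex summand, and of two different such families one majorizes
the other. So every semi-regular polygon attains the minimum of C for its S, which gives (i). For
(ii), equal S forces equal angles, unit perimeter forces the inradius 1/(2C), and the polygons are
congruent.

For L'Huilier's inequality, twice the area is a quadratic form in the support numbers. With the
origin at the centre of a circle touching three suitable sides, and its radius subtracted from the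
support numbers, the form splits over two arcs of turning at most π. On each it is nonpositive by a
discrete Wirtinger inequality. -/

theorem pos_of_hasDerivAt_pos {f f' : ℝ → ℝ} {a b : ℝ} (h0 : 0 ≤ f a)
    (hd : ∀ x, HasDerivAt f (f' x) x) (hpos : ∀ x ∈ Ioo a b, 0 < f' x) :
    ∀ x ∈ Ioo a b, 0 < f x := by
  intro x hx
  have hmono : StrictMonoOn f (Icc a x) := by
    apply strictMonoOn_of_deriv_pos (convex_Icc a x)
    · exact fun y _ => (hd y).continuousAt.continuousWithinAt
    · intro y hy
      rw [interior_Icc] at hy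
      rw [(hd y).deriv]
      exact hpos y ⟨hy.1, hy.2.trans hx.2⟩
  exact h0.trans_lt (hmono (left_mem_Icc.2 hx.1.le) (right_mem_Icc.2 hx.1.le) hx.1)

/-- Integrating `y * sin y > 0` three times from 0 gives the three auxiliary inequalities in turn.
This is the negativity of the third derivative of t cot(t/2) in disguise. -/
theorem three_mul_sin_lt {x : ℝ} (h0 : 0 < x) (hpi : x < π) : 3 * sin x < x * (2 + cos x) := by
  have h1 : ∀ y ∈ Ioo 0 π, 0 < sin y - y * cos y := by
    apply pos_of_hasDerivAt_pos (f' := fun y => y * sin y)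
    · simp
    · intro y
      refine ((hasDerivAt_sin y).sub ((hasDerivAt_id' y).mul (hasDerivAt_cos y))).congr_deriv ?_
      ring
    · exact fun y hy => mul_pos hy.1 (sin_pos_of_mem_Ioo hy)
  have h2 : ∀ y ∈ Ioo 0 π, 0 < 2 - 2 * cos y - y * sin y := by
    apply pos_of_hasDerivAt_pos (f' := fun y => sin y - y * cos y)
    · simp
    · intro y
      refine ((((hasDerivAt_cos y).const_mul 2).const_sub 2).sub
        ((hasDerivAt_id' y).mul (hasDerivAt_sin y))).congr_deriv ?_
      ring
    · exact h1
  have h3 : ∀ y ∈ Ioo 0 π, 0 < y * (2 + cos y) - 3 * sin y := by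
    apply pos_of_hasDerivAt_pos (f' := fun y => 2 - 2 * cos y - y * sin y)
    · simp
    · intro y
      refine (((hasDerivAt_id' y).mul ((hasDerivAt_cos y).const_add 2)).sub
        ((hasDerivAt_sin y).const_mul 3)).congr_deriv ?_
      ring
    · exact h2
  linarith [h3 x ⟨h0, hpi⟩]

/-- The cotangent of half the angle. -/
def halfCot (t : ℝ) : ℝ := cos (t / 2) / sin (t / 2)

theorem sin_half_pos {t : ℝ} (ht : t ∈ Ioc 0 π) : 0 < sin (t / 2) :=
  sin_pos_of_pos_of_lt_pi (by linarith [ht.1]) (by linarith [ht.2, pi_pos])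

theorem halfCot_pi : halfCot π = 0 := by simp [halfCot]

theorem hasDerivAt_halfCot {t : ℝ} (ht : t ∈ Ioc 0 π) :
    HasDerivAt halfCot (-(1 + halfCot t ^ 2) / 2) t := by
  have hs := (sin_half_pos ht).ne'
  have h2 : HasDerivAt (fun t : ℝ => t / 2) (1 / 2) t := (hasDerivAt_id t).div_const 2
  have hc := (hasDerivAt_cos (t / 2)).comp t h2
  have hsn := (hasDerivAt_sin (t / 2)).comp t h2
  refine (hc.div hsn hs).congr_deriv ?_
  simp only [halfCot, Function.comp]
  field_simp
  ring

theorem exists_deriv3_eq_zero {f f1 f2 f3 : ℝ → ℝ} {a b c d l u : ℝ}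
    (hl : l < a) (hab : a < b) (hbc : b < c) (hcd : c < d) (hu : d < u)
    (h1 : ∀ x ∈ Ioo l u, HasDerivAt f (f1 x) x)
    (h2 : ∀ x ∈ Ioo l u, HasDerivAt f1 (f2 x) x)
    (h3 : ∀ x ∈ Ioo l u, HasDerivAt f2 (f3 x) x)
    (ha : f a = 0) (hb : f b = 0) (hc : f c = 0) (hd : f d = 0) :
    ∃ ξ ∈ Ioo l u, f3 ξ = 0 := by
  have rolle : ∀ {g g' : ℝ → ℝ}, (∀ x ∈ Ioo l u, HasDerivAt g (g' x) x) → ∀ p q, l < p → p < q →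
      q < u → g p = 0 → g q = 0 → ∃ r ∈ Ioo p q, g' r = 0 := by
    intro g g' hg p q hp hpq hq gp gq
    apply exists_hasDerivAt_eq_zero hpq _ (gp.trans gq.symm)
    · exact fun x hx => hg x ⟨hp.trans hx.1, hx.2.trans hq⟩
    · exact fun x hx => (hg x ⟨hp.trans_le hx.1, hx.2.trans_lt hq⟩).continuousAt.continuousWithinAt
  obtain ⟨p, hp, hp0⟩ := rolle h1 a b hl hab (by linarith) ha hb
  obtain ⟨q, hq, hq0⟩ := rolle h1 b c (by linarith) hbc (by linarith) hb hc
  obtain ⟨r, hr, hr0⟩ := rolle h1 c d (by linarith) hcd hu hc hd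
  obtain ⟨s, hs, hs0⟩ := rolle h2 p q (by linarith [hp.1]) (by linarith [hp.2, hq.1])
    (by linarith [hq.2]) hp0 hq0
  obtain ⟨t, ht, ht0⟩ := rolle h2 q r (by linarith [hq.1]) (by linarith [hq.2, hr.1])
    (by linarith [hr.2]) hq0 hr0
  obtain ⟨ξ, hξ, hξ0⟩ := rolle h3 s t (by linarith [hs.1, hp.1]) (by linarith [hs.2, ht.1])
    (by linarith [ht.2, hr.2]) hs0 ht0
  exact ⟨ξ, ⟨by linarith [hξ.1, hs.1, hp.1], by linarith [hξ.2, ht.2, hr.2]⟩, hξ0⟩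

/-- If `t * halfCot t - (A + B t + C t²) - K (t - x) (t - y) (t - z)` has four zeros in `(0, π)`, then
`K < 0`, as the third derivative of `t * halfCot t` is negative. -/
theorem coeff_neg_of_four_zeros {a b c d A B C K x y z : ℝ} (hl : 0 < a) (hab : a < b)
    (hbc : b < c) (hcd : c < d) (hu : d < π)
    (h : ∀ t, t = a ∨ t = b ∨ t = c ∨ t = d →
      t * halfCot t - (A + B * t + C * t ^ 2) - K * ((t - x) * (t - y) * (t - z)) = 0) : K < 0 := by
  have key : ∀ t ∈ Ioo 0 π, HasDerivAt halfCot (-(1 + halfCot t ^ 2) / 2) t ∧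
      HasDerivAt (fun s : ℝ => s) 1 t ∧ HasDerivAt (fun s : ℝ => s - x) 1 t ∧
      HasDerivAt (fun s : ℝ => s - y) 1 t ∧ HasDerivAt (fun s : ℝ => s - z) 1 t := fun t ht =>
    ⟨hasDerivAt_halfCot ⟨ht.1, ht.2.le⟩, hasDerivAt_id' t, (hasDerivAt_id' t).sub_const x,
      (hasDerivAt_id' t).sub_const y, (hasDerivAt_id' t).sub_const z⟩
  obtain ⟨ξ, hξ, h0⟩ : ∃ ξ ∈ Ioo 0 π, 3 / 2 * halfCot ξ * (1 + halfCot ξ ^ 2) -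
      ξ * ((1 + 3 * halfCot ξ ^ 2) * (1 + halfCot ξ ^ 2) / 4) - 6 * K = 0 := by
    -- All derivatives are polynomials in `t` and `halfCot t`, since F = `halfCot` satisfies F' =
    -- -(1 + F²)/2. The cubic term contributes 6K to the third derivative.
    refine exists_deriv3_eq_zero
      (f := fun t => t * halfCot t - (A + B * t + C * t ^ 2) - K * ((t - x) * (t - y) * (t - z)))
      (f1 := fun t => halfCot t + t * (-(1 + halfCot t ^ 2) / 2) - (B + 2 * C * t) -
        K * ((t - y) * (t - z) + (t - x) * (t - z) + (t - x) * (t - y)))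
      (f2 := fun t => -(1 + halfCot t ^ 2) + t * (halfCot t * (1 + halfCot t ^ 2) / 2) - 2 * C -
        K * (2 * (t - x) + 2 * (t - y) + 2 * (t - z)))
      (f3 := fun t => 3 / 2 * halfCot t * (1 + halfCot t ^ 2) -
        t * ((1 + 3 * halfCot t ^ 2) * (1 + halfCot t ^ 2) / 4) - 6 * K)
      hl hab hbc hcd hu ?_ ?_ ?_ (h a (by simp)) (h b (by simp)) (h c (by simp)) (h d (by simp))
    · intro t ht
      obtain ⟨hF, hid, hx, hy, hz⟩ := key t ht
      refine (((hid.mul hF).sub (((hid.const_mul B).const_add A).add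
        ((hid.pow 2).const_mul C))).sub (((hx.mul hy).mul hz).const_mul K)).congr_deriv ?_
      simp; ring
    · intro t ht
      obtain ⟨hF, hid, hx, hy, hz⟩ := key t ht
      refine (((hF.add (hid.mul ((((hF.pow 2).const_add 1).neg).div_const 2))).sub
        ((hid.const_mul (2 * C)).const_add B)).sub
        ((((hy.mul hz).add (hx.mul hz)).add (hx.mul hy)).const_mul K)).congr_deriv ?_
      simp; ring
    · intro t ht
      obtain ⟨hF, hid, hx, hy, hz⟩ := key t ht
      refine (((((((hF.pow 2).const_add 1).neg).add
        (hid.mul ((hF.mul ((hF.pow 2).const_add 1)).div_const 2))).sub_const (2 * C))).sub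
        ((((hx.const_mul 2).add (hy.const_mul 2)).add (hz.const_mul 2)).const_mul K)).congr_deriv ?_
      simp; ring
  have hs := sin_half_pos ⟨hξ.1, hξ.2.le⟩
  have hc := three_mul_sin_lt hξ.1 hξ.2
  have hsin : sin ξ = 2 * sin (ξ / 2) * cos (ξ / 2) := by rw [← sin_two_mul]; ring_nf
  have hcos : cos ξ = 2 * cos (ξ / 2) ^ 2 - 1 := by rw [← cos_two_mul]; ring_nf
  have hsq := sin_sq_add_cos_sq (ξ / 2)
  -- Multiplied by sin²(ξ/2), this is `three_mul_sin_lt`.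
  have key : 6 * halfCot ξ < ξ * (1 + 3 * halfCot ξ ^ 2) := by
    have e1 : 6 * halfCot ξ = 3 * sin ξ / sin (ξ / 2) ^ 2 := by
      rw [hsin, halfCot]; field_simp; ring
    have e2 : ξ * (1 + 3 * halfCot ξ ^ 2) = ξ * (2 + cos ξ) / sin (ξ / 2) ^ 2 := by
      have : 2 + cos ξ = sin (ξ / 2) ^ 2 + 3 * cos (ξ / 2) ^ 2 := by linarith
      rw [this, halfCot]; field_simp
    rw [e1, e2]
    gcongr
  have : (6 * halfCot ξ - ξ * (1 + 3 * halfCot ξ ^ 2)) * (1 + halfCot ξ ^ 2) / 4 < 0 := by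
    have : (6 * halfCot ξ - ξ * (1 + 3 * halfCot ξ ^ 2)) * (1 + halfCot ξ ^ 2) < 0 :=
      mul_neg_of_neg_of_pos (by linarith) (by positivity)
    linarith
  have e : (6 * halfCot ξ - ξ * (1 + 3 * halfCot ξ ^ 2)) * (1 + halfCot ξ ^ 2) / 4 = 6 * K := by
    linarith
  linarith

theorem exists_quadratic_interpolation (g : ℝ → ℝ) {x y z : ℝ} (hxy : x < y) (hyz : y < z) :
    ∃ A B C : ℝ, g x = A + B * x + C * x ^ 2 ∧ g y = A + B * y + C * y ^ 2 ∧
      g z = A + B * z + C * z ^ 2 := by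
  -- Newton's form of the interpolant: `b` and `c` are the first and second divided differences.
  obtain ⟨b, hb⟩ : ∃ b, g y - g x = b * (y - x) :=
    ⟨(g y - g x) / (y - x), by field_simp [(sub_pos.2 hxy).ne']⟩
  obtain ⟨c, hc⟩ : ∃ c, g z - g x - b * (z - x) = c * ((z - x) * (z - y)) :=
    ⟨(g z - g x - b * (z - x)) / ((z - x) * (z - y)), by
      rw [div_mul_cancel₀]
      exact mul_ne_zero (sub_pos.2 (hxy.trans hyz)).ne' (sub_pos.2 hyz).ne'⟩
  exact ⟨g x - b * x + c * x * y, b - c * (x + y), c, by ring, by linear_combination hb,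
    by linear_combination hc⟩

/-- The interpolation error of t cot(t/2) is K (t - x)(t - y)(t - z) with K < 0, and the product is
negative at these `t`. Dividing by `t` leaves a combination of 1/t, 1 and t, exactly the functions
whose sums are preserved when angles are exchanged. -/
theorem interpolation_lt {x y z t A B C : ℝ} (hx : 0 < x) (hxy : x < y) (hyz : y < z) (hz : z < π)
    (hA : x * halfCot x = A + B * x + C * x ^ 2) (hB : y * halfCot y = A + B * y + C * y ^ 2)
    (hC : z * halfCot z = A + B * z + C * z ^ 2) (ht : 0 < t) (hcase : t < x ∨ y < t ∧ t < z) :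
    A / t + B + C * t < halfCot t := by
  have hp : (t - x) * (t - y) * (t - z) < 0 := by
    rcases hcase with h | h
    · exact mul_neg_of_pos_of_neg (mul_pos_of_neg_of_neg (by linarith) (by linarith)) (by linarith)
    · exact mul_neg_of_pos_of_neg (mul_pos (by linarith) (by linarith)) (by linarith)
  obtain ⟨K, hK⟩ : ∃ K, t * halfCot t - (A + B * t + C * t ^ 2) =
      K * ((t - x) * (t - y) * (t - z)) := ⟨_, (div_mul_cancel₀ _ hp.ne).symm⟩
  have hKneg : K < 0 := by
    rcases hcase with h | h
    · apply coeff_neg_of_four_zeros (A := A) (B := B) (C := C) (x := x) (y := y) (z := z)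
        ht h hxy hyz hz
      rintro s (rfl | rfl | rfl | rfl) <;> linarith
    · apply coeff_neg_of_four_zeros (A := A) (B := B) (C := C) (x := x) (y := y) (z := z)
        hx hxy h.1 h.2 hz
      rintro s (rfl | rfl | rfl | rfl) <;> linarith
  have hpos : 0 < t * halfCot t - (A + B * t + C * t ^ 2) := by
    rw [hK]; exact mul_pos_of_neg_of_neg hKneg hp
  have : t * (A / t + B + C * t) < t * halfCot t := by
    have : t * (A / t + B + C * t) = A + B * t + C * t ^ 2 := by field_simp
    linarith
  exact lt_of_mul_lt_mul_left this ht.le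

theorem exists_zero_Ioo {f : ℝ → ℝ} (hf : Continuous f) {a b : ℝ} (hab : a < b)
    (h : f a * f b < 0) : ∃ x ∈ Ioo a b, f x = 0 := by
  rcases mul_neg_iff.1 h with ⟨ha, hb⟩ | ⟨ha, hb⟩
  · exact intermediate_value_Ioo' hab.le hf.continuousOn ⟨hb, ha⟩
  · exact intermediate_value_Ioo hab.le hf.continuousOn ⟨ha, hb⟩

/-- Three angles of which the smallest is strictly smaller than the two others, all below `π`, can be
replaced by three angles with the same sum and the same sum of inverses, so that the sum of the
half-angle cotangents decreases. -/
theorem exists_better_triple {a b c : ℝ} (ha : 0 < a) (hab : a < b) (hbc : b ≤ c) (hc : c < π) :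
    ∃ x y z : ℝ, 0 < x ∧ 0 < y ∧ 0 < z ∧ x < π ∧ y < π ∧ z < π ∧ x + y + z = a + b + c ∧
      1 / x + 1 / y + 1 / z = 1 / a + 1 / b + 1 / c ∧
      halfCot x + halfCot y + halfCot z < halfCot a + halfCot b + halfCot c := by
  have hb : 0 < b := ha.trans hab
  have hc0 : 0 < c := hb.trans_le hbc
  set p : ℝ → ℝ := fun t => (t - a) * (t - b) * (t - c) with hp
  set m := (a + b) / 2 with hm
  have ham : a < m := by rw [hm]; linarith
  have hmb : m < b := by rw [hm]; linarith
  have hpm : 0 < p m :=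
    mul_pos_of_neg_of_neg (mul_neg_of_pos_of_neg (by linarith) (by linarith)) (by linarith)
  have hppi : 0 < p π := mul_pos (mul_pos (by linarith) (by linarith)) (by linarith)
  -- With e₂, e₃ the elementary symmetric functions of a, b, c and τ = e₃/e₂, subtracting δ(t - τ)
  -- from the cubic `p` replaces e₂, e₃ by e₂ - δ, e₃ - δτ. This keeps the sum of the roots and the
  -- ratio e₂/e₃, which is the sum of their inverses.
  set τ := a * b * c / (a * b + a * c + b * c) with hτ
  have he2 : 0 < a * b + a * c + b * c := by positivity
  have hτ0 : 0 < τ := by positivity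
  have hτa : τ < a := by
    rw [hτ, div_lt_iff₀ he2]
    have : 0 < a * (a * b + a * c) := by positivity
    nlinarith
  -- For such a small δ, `q` is negative at a, b, c and still positive at m and π, so its roots
  -- satisfy a < x < m < y < b and c < z < π.
  obtain ⟨δ, hδ, hδm, hδpi⟩ : ∃ δ : ℝ, 0 < δ ∧ δ * π < p m ∧ δ * π < p π := by
    obtain ⟨e, he, he'⟩ := exists_between (lt_min hpm hppi)
    have h : e / π * π = e := div_mul_cancel₀ _ pi_ne_zero
    exact ⟨e / π, div_pos he pi_pos, h.symm ▸ (lt_min_iff.1 he').1, h.symm ▸ (lt_min_iff.1 he').2⟩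
  set q : ℝ → ℝ := fun t => p t - δ * (t - τ) with hq
  have hqc : Continuous q := by fun_prop
  have hneg : ∀ t, p t = 0 → τ < t → q t < 0 := fun t h0 h => by
    simp only [hq, h0]
    have := mul_pos hδ (sub_pos.2 h)
    linarith
  have hpos : ∀ t, t ≤ π → δ * π < p t → 0 < q t := fun t h0 h => by
    simp only [hq]
    have := mul_le_mul_of_nonneg_left (show t - τ ≤ π by linarith) hδ.le
    linarith
  have hqa := hneg a (by simp [hp]) hτa
  have hqb := hneg b (by simp [hp]) (by linarith)
  have hqc' := hneg c (by simp [hp]) (by linarith)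
  have hqm := hpos m (by linarith) hδm
  have hqpi := hpos π le_rfl hδpi
  obtain ⟨x, hx, hx0⟩ := exists_zero_Ioo hqc ham (mul_neg_of_neg_of_pos hqa hqm)
  obtain ⟨y, hy, hy0⟩ := exists_zero_Ioo hqc hmb (mul_neg_of_pos_of_neg hqm hqb)
  obtain ⟨z, hz, hz0⟩ := exists_zero_Ioo hqc hc (mul_neg_of_neg_of_pos hqc' hqpi)
  have hxy : x < y := hx.2.trans hy.1
  have hyz : y < z := (hy.2.trans_le hbc).trans hz.1
  have hx1 : 0 < x := ha.trans hx.1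
  have hy1 : 0 < y := hx1.trans hxy
  have hz1 : 0 < z := hy1.trans hyz
  simp only [hq, hp] at hx0 hy0 hz0
  have hxy' : (x - y) ≠ 0 := (sub_neg.2 hxy).ne
  have hxz' : (x - z) ≠ 0 := (sub_neg.2 (hxy.trans hyz)).ne
  have hyz' : (y - z) ≠ 0 := (sub_neg.2 hyz).ne
  -- Vieta's relations for `q`, obtained by dividing differences of the root equations.
  have h1 : x ^ 2 + x * y + y ^ 2 - (a + b + c) * (x + y) + (a * b + a * c + b * c - δ) = 0 :=
    mul_left_cancel₀ hxy' (by linear_combination hx0 - hy0)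
  have h2 : x ^ 2 + x * z + z ^ 2 - (a + b + c) * (x + z) + (a * b + a * c + b * c - δ) = 0 :=
    mul_left_cancel₀ hxz' (by linear_combination hx0 - hz0)
  have hsum : x + y + z = a + b + c := by
    have : x + y + z - (a + b + c) = 0 := mul_left_cancel₀ hyz' (by linear_combination h1 - h2)
    linarith
  have hE2 : x * y + x * z + y * z = a * b + a * c + b * c - δ := by
    linear_combination (-1 : ℝ) * h1 + (x + y) * hsum
  have hE3 : x * y * z = a * b * c - δ * τ := by
    linear_combination hx0 + x ^ 2 * hsum * (-1) + x * hE2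
  have hinv : 1 / x + 1 / y + 1 / z = 1 / a + 1 / b + 1 / c := by
    have e1 : 1 / x + 1 / y + 1 / z = (x * y + x * z + y * z) / (x * y * z) := by
      field_simp; ring
    have e2 : 1 / a + 1 / b + 1 / c = (a * b + a * c + b * c) / (a * b * c) := by
      field_simp; ring
    have hτ' : τ * (a * b + a * c + b * c) = a * b * c := div_mul_cancel₀ _ he2.ne'
    rw [e1, e2, div_eq_div_iff (by positivity) (by positivity), hE2, hE3]
    linear_combination δ * hτ'
  refine ⟨x, y, z, hx1, hy1, hz1, by linarith [hx.2], by linarith [hy.2], hz.2, hsum, hinv, ?_⟩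
  obtain ⟨A, B, C, hA, hB, hC⟩ :=
    exists_quadratic_interpolation (fun t => t * halfCot t) hxy hyz
  -- The quadratic interpolates at x, y, z; a lies to the left of x, while b and c lie between y and
  -- z.
  have ka := interpolation_lt hx1 hxy hyz hz.2 hA hB hC ha (Or.inl hx.1)
  have kb := interpolation_lt hx1 hxy hyz hz.2 hA hB hC hb (Or.inr ⟨hy.2, by linarith [hz.1]⟩)
  have kc := interpolation_lt hx1 hxy hyz hz.2 hA hB hC hc0 (Or.inr ⟨by linarith [hy.2], hz.1⟩)
  have lx : halfCot x = A / x + B + C * x := by field_simp; linarith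
  have ly : halfCot y = A / y + B + C * y := by field_simp; linarith
  have lz : halfCot z = A / z + B + C * z := by field_simp; linarith
  have e : A / x + A / y + A / z = A / a + A / b + A / c := by
    linear_combination A * hinv
  have e' : C * x + C * y + C * z = C * a + C * b + C * c := by linear_combination C * hsum
  linarith

/-- The contribution of an angle to the sum `S`. -/
def angleTerm (t : ℝ) : ℝ := (π ^ 2 - t ^ 2) / t

theorem angleTerm_pi : angleTerm π = 0 := by simp [angleTerm]

theorem angleTerm_eq {t : ℝ} (ht : t ≠ 0) : angleTerm t = π ^ 2 * (1 / t) - t := by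
  unfold angleTerm; field_simp

theorem angleTerm_nonneg {t : ℝ} (ht : t ∈ Ioc 0 π) : 0 ≤ angleTerm t :=
  div_nonneg (by nlinarith [ht.1, ht.2]) ht.1.le

/-! ### Existence and shape of the minimising angle families -/

section Minimizer

variable {ι : Type*} [Fintype ι]

/-- The families of angles in `(0, π]` with prescribed sum and prescribed value of `S`. -/
def angleFamilies (ι : Type*) [Fintype ι] (σ s : ℝ) : Set (ι → ℝ) :=
  {η | (∀ i, η i ∈ Ioc 0 π) ∧ ∑ i, η i = σ ∧ ∑ i, angleTerm (η i) = s}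

theorem exists_isMinOn_angleFamilies {σ s : ℝ} (h : (angleFamilies ι σ s).Nonempty) :
    ∃ η ∈ angleFamilies ι σ s, IsMinOn (fun η => ∑ i, halfCot (η i)) (angleFamilies ι σ s) η := by
  have hs : 0 ≤ s := by
    obtain ⟨η, h1, -, h3⟩ := h
    rw [← h3]; exact Finset.sum_nonneg fun i _ => angleTerm_nonneg (h1 i)
  -- A single term (π² - t²)/t is at most s, so π² ≤ s t + t² ≤ (s + π) t: the angles stay away from
  -- 0, and the family space is compact.
  set ε := π ^ 2 / (s + π) with hε
  have hspi : 0 < s + π := by linarith [pi_pos]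
  have hε0 : 0 < ε := div_pos (by positivity) hspi
  have hle : ∀ η ∈ angleFamilies ι σ s, ∀ i, η i ∈ Icc ε π := by
    rintro η ⟨h1, -, h3⟩ i
    refine ⟨?_, (h1 i).2⟩
    have h4 : angleTerm (η i) ≤ s := by
      rw [← h3]
      exact Finset.single_le_sum (f := fun i => angleTerm (η i))
        (fun i _ => angleTerm_nonneg (h1 i)) (Finset.mem_univ i)
    rw [angleTerm, div_le_iff₀ (h1 i).1] at h4
    rw [hε, div_le_iff₀ hspi]
    nlinarith [(h1 i).1, (h1 i).2]
  set box : Set (ι → ℝ) := Set.pi univ fun _ => Icc ε π with hbox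
  have hboxc : IsCompact box := isCompact_univ_pi fun _ => isCompact_Icc
  have hpos : ∀ η ∈ box, ∀ i, η i ∈ Ioc 0 π := fun η hη i =>
    ⟨hε0.trans_le (hη i (mem_univ i)).1, (hη i (mem_univ i)).2⟩
  have hcont : ∀ g : ℝ → ℝ, ContinuousOn g (Ioc 0 π) →
      ContinuousOn (fun η : ι → ℝ => ∑ i, g (η i)) box := fun g hg =>
    continuousOn_finsetSum _ fun i _ =>
      hg.comp (continuous_apply i).continuousOn fun η hη => hpos η hη i
  have hterm : ContinuousOn angleTerm (Ioc 0 π) := by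
    unfold angleTerm
    exact ContinuousOn.div (by fun_prop) (by fun_prop) fun t ht => ht.1.ne'
  have hcot : ContinuousOn halfCot (Ioc 0 π) := fun t ht =>
    (hasDerivAt_halfCot ht).continuousAt.continuousWithinAt
  have hsub : angleFamilies ι σ s = box ∩
      (fun η : ι → ℝ => (∑ i, η i, ∑ i, angleTerm (η i))) ⁻¹' {(σ, s)} := by
    ext η
    constructor
    · intro hη
      exact ⟨fun i _ => hle η hη i, by simp [hη.2.1, hη.2.2]⟩
    · rintro ⟨h1, h2⟩
      simp only [mem_preimage, mem_singleton_iff, Prod.mk.injEq] at h2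
      exact ⟨hpos η h1, h2.1, h2.2⟩
  have hcomp : IsCompact (angleFamilies ι σ s) := by
    rw [hsub]
    refine hboxc.of_isClosed_subset ?_ inter_subset_left
    refine ContinuousOn.preimage_isClosed_of_isClosed ?_ hboxc.isClosed isClosed_singleton
    exact (hcont id continuousOn_id).prodMk (hcont _ hterm)
  refine hcomp.exists_isMinOn h ((hcont _ hcot).mono ?_)
  rw [hsub]; exact inter_subset_left

variable [DecidableEq ι]

theorem sum_comp_update (g : ℝ → ℝ) (η : ι → ℝ) (i : ι) (x : ℝ) :
    ∑ l, g (Function.update η i x l) = ∑ l, g (η l) - g (η i) + g x := by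
  rw [← Finset.add_sum_erase _ _ (Finset.mem_univ i),
    ← Finset.add_sum_erase _ (fun l => g (η l)) (Finset.mem_univ i)]
  have : ∑ l ∈ Finset.univ.erase i, g (Function.update η i x l) =
      ∑ l ∈ Finset.univ.erase i, g (η l) :=
    Finset.sum_congr rfl fun l hl => by rw [Function.update_of_ne (Finset.ne_of_mem_erase hl)]
  rw [this]; simp; ring

/-- Since `angleTerm t` is π²/t - t, the exchange of `exists_better_triple` stays within the family
and would lower the minimum. It needs room for the largest angle to grow, so only the value π
escapes. -/
theorem not_lt_le_lt_of_isMinOn {σ s : ℝ} {η : ι → ℝ} (hη : η ∈ angleFamilies ι σ s)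
    (hmin : IsMinOn (fun η => ∑ i, halfCot (η i)) (angleFamilies ι σ s) η) {i j k : ι}
    (hij : i ≠ j) (hik : i ≠ k) (hjk : j ≠ k) (h1 : η i < η j) (h2 : η j ≤ η k) : η k = π := by
  by_contra hk
  have h3 : η k < π := lt_of_le_of_ne (hη.1 k).2 hk
  obtain ⟨x, y, z, hx, hy, hz, hx', hy', hz', hsum, hinv, hlt⟩ :=
    exists_better_triple (hη.1 i).1 h1 h2 h3
  set ζ := Function.update (Function.update (Function.update η i x) j y) k z with hζ
  have hg : ∀ g : ℝ → ℝ, ∑ l, g (ζ l) =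
      ∑ l, g (η l) - (g (η i) + g (η j) + g (η k)) + (g x + g y + g z) := by
    intro g
    rw [hζ, sum_comp_update, sum_comp_update, sum_comp_update]
    simp only [Function.update_of_ne hij.symm, Function.update_of_ne hik.symm,
      Function.update_of_ne hjk.symm]
    ring
  have hmem : ζ ∈ angleFamilies ι σ s := by
    refine ⟨fun l => ?_, ?_, ?_⟩
    · rw [hζ]
      by_cases hl : l = k
      · subst hl; simpa using ⟨hz, hz'.le⟩
      rw [Function.update_of_ne hl]
      by_cases hl : l = j
      · subst hl; simpa using ⟨hy, hy'.le⟩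
      rw [Function.update_of_ne hl]
      by_cases hl : l = i
      · subst hl; simpa using ⟨hx, hx'.le⟩
      rw [Function.update_of_ne hl]
      exact hη.1 l
    · have := hg id
      simp only [id] at this
      rw [this, hη.2.1]; linarith
    · rw [hg, hη.2.2, angleTerm_eq hx.ne', angleTerm_eq hy.ne', angleTerm_eq hz.ne',
        angleTerm_eq (hη.1 i).1.ne', angleTerm_eq (hη.1 j).1.ne', angleTerm_eq (hη.1 k).1.ne']
      linear_combination π ^ 2 * hinv - hsum
  have h4 : ∑ l, halfCot (η l) ≤ ∑ l, halfCot (ζ l) := hmin hmem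
  rw [hg] at h4
  linarith

end Minimizer

/-- All entries of the family are equal, except that possibly one of them is larger. -/
def EqualButOneLarger {ι : Type*} (w : ι → ℝ) : Prop :=
  ∃ (j : ι) (α : ℝ), (∀ i, i ≠ j → w i = α) ∧ α ≤ w j

/-- A minimal entry together with two entries above it, in the right order, would be a forbidden
triple; hence at most one entry exceeds the minimum. -/
theorem equalButOneLarger_of_no_triple {ι : Type*} [Finite ι] [Nonempty ι] {w : ι → ℝ}
    (h : ∀ i j k, i ≠ j → i ≠ k → j ≠ k → w i < w j → ¬ w j ≤ w k) : EqualButOneLarger w := by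
  obtain ⟨i, hi⟩ := Finite.exists_min w
  by_cases hall : ∀ j, w j = w i
  · exact ⟨i, w i, fun j _ => hall j, le_rfl⟩
  push Not at hall
  obtain ⟨j, hj⟩ := hall
  have hij : w i < w j := lt_of_le_of_ne (hi j) hj.symm
  refine ⟨j, w i, fun k hk => ?_, hi j⟩
  by_contra hki
  have hik : w i < w k := lt_of_le_of_ne (hi k) (Ne.symm hki)
  have n1 : i ≠ j := by rintro rfl; exact hij.false
  have n2 : i ≠ k := by rintro rfl; exact hik.false
  rcases le_total (w j) (w k) with h' | h'
  · exact h i j k n1 n2 hk.symm hij h'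
  · exact h i k j n2 n1 hk hik h'

/-- Among the families of angles in `(0, π)` with exterior angle sum `2π` and a prescribed value of
`S`, the least sum of half-angle cotangents occurs for one of the shape `EqualButOneLarger`,
and only for such. -/
theorem exists_equalButOneLarger_le {N : ℕ} {θ : Fin N → ℝ} (hθ : ∀ i, θ i ∈ Ioo 0 π)
    (hsum : ∑ i, (π - θ i) = 2 * π) :
    ∃ (n : ℕ) (w : Fin n → ℝ), (∀ i, w i ∈ Ioo 0 π) ∧ EqualButOneLarger w ∧
      ∑ i, (π - w i) = 2 * π ∧ ∑ i, angleTerm (w i) = ∑ i, angleTerm (θ i) ∧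
      ∑ i, halfCot (w i) ≤ ∑ i, halfCot (θ i) ∧
      (∑ i, halfCot (w i) = ∑ i, halfCot (θ i) → EqualButOneLarger θ) := by
  set σ := ∑ i, θ i with hσ
  set s := ∑ i, angleTerm (θ i) with hs
  have hθm : θ ∈ angleFamilies (Fin N) σ s := ⟨fun i => ⟨(hθ i).1, (hθ i).2.le⟩, rfl, rfl⟩
  obtain ⟨η, hη, hmin⟩ := exists_isMinOn_angleFamilies ⟨θ, hθm⟩
  have hηsum : ∑ i, (π - η i) = 2 * π := by
    rw [← hsum, Finset.sum_sub_distrib, Finset.sum_sub_distrib, hη.2.1]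
  -- Angles equal to π are dropped: every `g` that matters vanishes at π, so its sum is unchanged.
  -- The number of angles may decrease.
  set A := Finset.univ.filter fun i => η i ≠ π with hA
  set w : Fin A.card → ℝ := fun i => η (A.equivFin.symm i) with hw
  have hg : ∀ g : ℝ → ℝ, g π = 0 → ∑ i, g (w i) = ∑ i, g (η i) := by
    intro g h0
    have e1 : ∑ i, g (w i) = ∑ i : A, g (η i) :=
      Equiv.sum_comp A.equivFin.symm fun i : A => g (η i)
    rw [e1, Finset.sum_coe_sort A fun i => g (η i), hA, Finset.sum_filter]
    refine Finset.sum_congr rfl fun i _ => ?_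
    by_cases h : η i = π <;> simp [h, h0]
  have hwne : ∀ i, w i ≠ π := fun i => (Finset.mem_filter.1 (A.equivFin.symm i).2).2
  have hwI : ∀ i, w i ∈ Ioo 0 π := fun i =>
    ⟨(hη.1 _).1, lt_of_le_of_ne (hη.1 _).2 (hwne i)⟩
  have hwsum : ∑ i, (π - w i) = 2 * π := by
    rw [← hηsum]; exact hg (fun t => π - t) (by simp)
  have hne : Nonempty (Fin A.card) := by
    by_contra hc
    rw [not_nonempty_iff] at hc
    rw [Finset.univ_eq_empty, Finset.sum_empty] at hwsum
    linarith [pi_pos]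
  have hNe : Nonempty (Fin N) := ⟨A.equivFin.symm hne.some⟩
  refine ⟨A.card, w, hwI, equalButOneLarger_of_no_triple ?_, hwsum, ?_, ?_, ?_⟩
  · intro i j k hij hik hjk h1 h2
    refine hwne k (not_lt_le_lt_of_isMinOn hη hmin ?_ ?_ ?_ h1 h2) <;>
      simpa [Subtype.ext_iff.symm]
  · rw [hg _ angleTerm_pi, hη.2.2]
  · rw [hg _ halfCot_pi]; exact hmin hθm
  · intro heq
    rw [hg _ halfCot_pi] at heq
    -- In the case of equality `θ` is itself a minimiser, and as none of its angles is π, the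
    -- exchange argument applies to it directly.
    have hmin' : IsMinOn (fun η => ∑ i, halfCot (η i)) (angleFamilies (Fin N) σ s) θ := by
      intro ζ hζ
      change ∑ i, halfCot (θ i) ≤ ∑ i, halfCot (ζ i)
      rw [← heq]; exact hmin hζ
    refine equalButOneLarger_of_no_triple fun i j k hij hik hjk h1 h2 => (hθ k).2.ne ?_
    exact not_lt_le_lt_of_isMinOn hθm hmin' hij hik hjk h1 h2

/-! ### S determines a family with at most one larger angle -/

theorem tangent_le_div_sub {u v : ℝ} (hu : u < π) (hv : v < π) :
    u / (π - u) + π / (π - u) ^ 2 * (v - u) ≤ v / (π - v) := by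
  have h1 : 0 < π - u := by linarith
  have h2 : 0 < π - v := by linarith
  have : v / (π - v) - (u / (π - u) + π / (π - u) ^ 2 * (v - u)) =
      π * (v - u) ^ 2 / ((π - v) * (π - u) ^ 2) := by
    field_simp; ring
  have : 0 ≤ π * (v - u) ^ 2 / ((π - v) * (π - u) ^ 2) := by positivity
  linarith

theorem tangent_lt_div_sub {u v : ℝ} (hu : u < π) (hv : v < π) (huv : u ≠ v) :
    u / (π - u) + π / (π - u) ^ 2 * (v - u) < v / (π - v) := by
  have h1 : 0 < π - u := by linarith
  have h2 : 0 < π - v := by linarith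
  have : v / (π - v) - (u / (π - u) + π / (π - u) ^ 2 * (v - u)) =
      π * (v - u) ^ 2 / ((π - v) * (π - u) ^ 2) := by
    field_simp; ring
  have h3 : v - u ≠ 0 := sub_ne_zero.2 huv.symm
  have : 0 < π * (v - u) ^ 2 / ((π - v) * (π - u) ^ 2) := by positivity
  linarith

/-- Here a, a' are the repeated exterior angles and b, b' the smaller exceptional ones. Padded with
zeros, the family with the larger repeated angle majorizes the other, and u/(π - u) is strictly
convex and vanishes at 0. The proof is Karamata's inequality by hand, with tangent lines. -/
theorem semiregular_sum_lt {M M' : ℕ} {a b a' b' : ℝ} (hM' : 1 ≤ M') (hb : 0 < b) (hba : b ≤ a)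
    (ha : a < π) (hb' : 0 < b') (hba' : b' ≤ a') (ha' : a' < π)
    (hsum : M * a + b = M' * a' + b') (haa : a < a') :
    M * (a / (π - a)) + b / (π - b) < M' * (a' / (π - a')) + b' / (π - b') := by
  have ha0 : 0 < a := hb.trans_le hba
  have hMM : M' ≤ M := by
    by_contra! hlt
    have h1 : (M : ℝ) + 1 ≤ M' := by exact_mod_cast hlt
    have h2 : (M + 1 : ℝ) * a' ≤ M' * a' := mul_le_mul_of_nonneg_right h1 (by linarith)
    have h3 : (M : ℝ) * a ≤ M * a' := mul_le_mul_of_nonneg_left haa.le (by positivity)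
    linarith
  have hM1 : (1 : ℝ) ≤ M' := by exact_mod_cast hM'
  have t1 : M' * (a / (π - a) + π / (π - a) ^ 2 * (a' - a)) < M' * (a' / (π - a')) :=
    mul_lt_mul_of_pos_left (tangent_lt_div_sub ha ha' haa.ne) (by linarith)
  rcases hMM.eq_or_lt with rfl | hlt
  · have hbb : b' ≤ b := by
      have : (M' : ℝ) * a ≤ M' * a' := mul_le_mul_of_nonneg_left haa.le (by positivity)
      linarith
    have t2 := tangent_le_div_sub (hba.trans_lt ha) (hba'.trans_lt ha')
    have t3 : π / (π - b) ^ 2 ≤ π / (π - a) ^ 2 := by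
      have : 0 < π - a := by linarith
      gcongr
    have t4 := mul_le_mul_of_nonneg_right t3 (sub_nonneg.2 hbb)
    have t5 : (M' : ℝ) * (a' - a) = b - b' := by linarith
    have t6 : (M' : ℝ) * (π / (π - a) ^ 2 * (a' - a)) = π / (π - a) ^ 2 * (b - b') := by
      rw [← t5]; ring
    linarith
  -- The M copies of a are paired with M' copies of a', with b', and with M - M' - 1 zeros, all by
  -- the tangent at a. The entry b is paired with 0, using that its value is at most b times the
  -- slope at a.
  · have t2 := tangent_le_div_sub ha (hba'.trans_lt ha')
    have h1 : (M' : ℝ) + 1 ≤ M := by exact_mod_cast hlt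
    have t3 := tangent_le_div_sub ha pi_pos
    have t4 : b / (π - b) ≤ π / (π - a) ^ 2 * b := by
      have e1 : 0 < π - a := by linarith
      have e2 : 0 < π - b := by linarith
      rw [div_mul_eq_mul_div, div_le_div_iff₀ e2 (by positivity)]
      have : (π - a) * (π - a) ≤ π * (π - b) := by
        apply mul_le_mul <;> linarith
      nlinarith
    have t5 := mul_le_mul_of_nonneg_left t3 (sub_nonneg.2 h1)
    have t6 : ((M : ℝ) - (M' + 1)) * (0 - a) + M' * (a' - a) + (b' - a) - b = 0 := by linarith
    have t7 : ((M : ℝ) - (M' + 1)) * (π / (π - a) ^ 2 * (0 - a)) +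
      M' * (π / (π - a) ^ 2 * (a' - a)) + π / (π - a) ^ 2 * (b' - a) - π / (π - a) ^ 2 * b = 0 := by
      linear_combination π / (π - a) ^ 2 * t6
    simp only [zero_div, mul_zero] at t5
    linarith

theorem sum_of_equalButOneLarger {n : ℕ} {w : Fin (n + 1) → ℝ} {j : Fin (n + 1)} {α : ℝ}
    (h : ∀ i, i ≠ j → w i = α) (g : ℝ → ℝ) : ∑ i, g (w i) = n * g α + g (w j) := by
  rw [← Finset.sum_erase_add _ _ (Finset.mem_univ j),
    Finset.sum_congr rfl fun i hi => by rw [h i (Finset.ne_of_mem_erase hi)]]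
  simp

/-- The value of `S` determines a family of angles of the shape `EqualButOneLarger`. -/
theorem equalButOneLarger_unique {n m : ℕ} {w : Fin n → ℝ} {v : Fin m → ℝ} {j : Fin n} {k : Fin m}
    {α β : ℝ} (hw : ∀ i, w i ∈ Ioo 0 π) (hv : ∀ i, v i ∈ Ioo 0 π) (hn : 2 ≤ n) (hm : 2 ≤ m)
    (hj : ∀ i, i ≠ j → w i = α) (hα : α ≤ w j) (hk : ∀ i, i ≠ k → v i = β) (hβ : β ≤ v k)
    (hws : ∑ i, (π - w i) = 2 * π) (hvs : ∑ i, (π - v i) = 2 * π)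
    (hS : ∑ i, angleTerm (w i) = ∑ i, angleTerm (v i)) : n = m ∧ α = β ∧ w j = v k := by
  obtain ⟨n, rfl⟩ : ∃ n', n = n' + 1 := ⟨n - 1, by omega⟩
  obtain ⟨m, rfl⟩ : ∃ m', m = m' + 1 := ⟨m - 1, by omega⟩
  -- With u = π - θ, (π² - θ²)/θ = π u/(π - u) + u. As the u sum to 2π, only the convex part
  -- distinguishes the values of S.
  have key : ∀ (n : ℕ) (w : Fin (n + 1) → ℝ) (j : Fin (n + 1)) (α : ℝ), 2 ≤ n + 1 →
      (∀ i, w i ∈ Ioo 0 π) → (∀ i, i ≠ j → w i = α) → 0 < α ∧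
      ∑ i, angleTerm (w i) = π * (n * ((π - α) / (π - (π - α))) + (π - w j) / (π - (π - w j))) +
        ∑ i, (π - w i) := by
    intro n w j α hn hw hj
    have : Nontrivial (Fin (n + 1)) := Fin.nontrivial_iff_two_le.2 hn
    obtain ⟨i, hi⟩ := exists_ne j
    have hα : 0 < α := hj i hi ▸ (hw i).1
    have hwj := (hw j).1
    refine ⟨hα, ?_⟩
    rw [sum_of_equalButOneLarger hj angleTerm, sum_of_equalButOneLarger hj fun t => π - t]
    simp only [sub_sub_cancel, angleTerm]
    field_simp
    ring
  obtain ⟨hα0, kw⟩ := key n w j α hn hw hj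
  obtain ⟨hβ0, kv⟩ := key m v k β hm hv hk
  rw [kw, kv, hws, hvs] at hS
  have hS' := mul_left_cancel₀ pi_ne_zero (add_right_cancel hS)
  rw [sum_of_equalButOneLarger hj fun t => π - t] at hws
  rw [sum_of_equalButOneLarger hk fun t => π - t] at hvs
  have hwj := hw j
  have hvk := hv k
  have hαβ : α = β := by
    rcases lt_trichotomy α β with h | h | h
    · refine absurd hS' (semiregular_sum_lt (by omega) ?_ ?_ ?_ ?_ ?_ ?_ (hvs.trans hws.symm) ?_).ne'
      all_goals linarith [hwj.1, hwj.2, hvk.1, hvk.2]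
    · exact h
    · refine absurd hS' (semiregular_sum_lt (by omega) ?_ ?_ ?_ ?_ ?_ ?_ (hws.trans hvs.symm) ?_).ne
      all_goals linarith [hwj.1, hwj.2, hvk.1, hvk.2]
  subst hαβ
  have hapos : 0 < π - α := by linarith [hwj.2]
  -- With a common repeated exterior angle, the exceptional one is positive and no larger, so the
  -- total 2π fixes the number of copies.
  have le_of : ∀ {p q : ℕ} {x y : ℝ}, p * (π - α) + (π - x) = 2 * π → q * (π - α) + (π - y) = 2 * π →
      α ≤ y → x < π → p ≤ q := by
    intro p q x y h1 h2 h3 h4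
    by_contra! hlt
    have h5 : (q : ℝ) + 1 ≤ p := by exact_mod_cast hlt
    have := mul_le_mul_of_nonneg_right h5 hapos.le
    linarith
  have hnm : n = m := le_antisymm (le_of hws hvs hβ hwj.2) (le_of hvs hws hα hvk.2)
  subst hnm
  exact ⟨rfl, rfl, by linarith⟩

/-! ### The quadratic form of the area in terms of support numbers -/

/-- Contribution of a vertex with exterior angle `x`, whose sides have support numbers `a` and `b`,
to twice the area. -/
def vertexForm (x a b : ℝ) : ℝ := (2 * a * b - (a ^ 2 + b ^ 2) * cos x) / sin x

/-- The direction angle after the first `m` turns. -/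
def turning (x : ℕ → ℝ) (m : ℕ) : ℝ := ∑ i ∈ Finset.range m, x i

@[simp] theorem turning_zero (x : ℕ → ℝ) : turning x 0 = 0 := by simp [turning]

theorem turning_succ (x : ℕ → ℝ) (m : ℕ) : turning x (m + 1) = turning x m + x m := by
  simp [turning, Finset.sum_range_succ]

theorem turning_strictMono {x : ℕ → ℝ} (hx : ∀ i, x i ∈ Ioo 0 π) : StrictMono (turning x) :=
  strictMono_nat_of_lt_succ fun m => by rw [turning_succ]; linarith [(hx m).1]

theorem turning_add (x : ℕ → ℝ) (p m : ℕ) :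
    turning x (p + m) = turning x p + turning (fun i => x (p + i)) m := by
  simp [turning, Finset.sum_range_add]

theorem turning_pos {x : ℕ → ℝ} (hx : ∀ i, x i ∈ Ioo 0 π) {m : ℕ} (hm : 0 < m) :
    0 < turning x m := by
  simpa using turning_strictMono hx hm

/-- Discrete Riccati argument: sin of the turning angle is the solution starting at 0, and each new
vertex lowers the left side by a square that vanishes only if k continues as a multiple of it. -/
theorem sum_vertexForm_add_le {x k : ℕ → ℝ} (hx : ∀ i, x i ∈ Ioo 0 π) (h0 : k 0 = 0) (m : ℕ)
    (hm : turning x (m + 1) < π) :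
    ∑ i ∈ Finset.range (m + 1), vertexForm (x i) (k i) (k (i + 1)) +
        k (m + 1) ^ 2 * (cos (turning x (m + 1)) / sin (turning x (m + 1))) ≤ 0 ∧
      (∑ i ∈ Finset.range (m + 1), vertexForm (x i) (k i) (k (i + 1)) +
        k (m + 1) ^ 2 * (cos (turning x (m + 1)) / sin (turning x (m + 1))) = 0 →
        ∃ μ, ∀ i ≤ m + 1, k i = μ * sin (turning x i)) := by
  induction m with
  | zero =>
    have hs : sin (x 0) ≠ 0 := (sin_pos_of_mem_Ioo (hx 0)).ne'
    have e : ∑ i ∈ Finset.range (0 + 1), vertexForm (x i) (k i) (k (i + 1)) +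
        k (0 + 1) ^ 2 * (cos (turning x (0 + 1)) / sin (turning x (0 + 1))) = 0 := by
      simp [turning_succ, vertexForm, h0]; field_simp; ring
    refine ⟨e.le, fun _ => ⟨k 1 / sin (x 0), fun i hi => ?_⟩⟩
    obtain rfl | rfl : i = 0 ∨ i = 1 := by omega
    · simp [h0]
    · simp [turning, hs]
  | succ m ih =>
    set Φ := turning x (m + 1) with hΦ
    have hsucc : turning x (m + 1 + 1) = Φ + x (m + 1) := turning_succ x (m + 1)
    have hΦpi : Φ < π := (turning_strictMono hx (Nat.lt_succ_self (m + 1))).trans hm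
    obtain ⟨ih1, ih2⟩ := ih hΦpi
    have hΦ0 : 0 < Φ := turning_pos hx m.succ_pos
    have s1 : 0 < sin Φ := sin_pos_of_pos_of_lt_pi hΦ0 hΦpi
    have s2 : 0 < sin (x (m + 1)) := sin_pos_of_mem_Ioo (hx _)
    have s3 : 0 < sin (Φ + x (m + 1)) :=
      sin_pos_of_pos_of_lt_pi (by linarith [(hx (m + 1)).1]) (by rw [← hsucc]; exact hm)
    rw [Finset.sum_range_succ, hsucc]
    set E := ∑ i ∈ Finset.range (m + 1), vertexForm (x i) (k i) (k (i + 1)) with hE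
    set a := k (m + 1)
    set b := k (m + 1 + 1)
    have hid : E + vertexForm (x (m + 1)) a b +
        b ^ 2 * (cos (Φ + x (m + 1)) / sin (Φ + x (m + 1))) =
        (E + a ^ 2 * (cos Φ / sin Φ)) - (a * sin (Φ + x (m + 1)) - b * sin Φ) ^ 2 /
          (sin Φ * sin (x (m + 1)) * sin (Φ + x (m + 1))) := by
      have p1 := sin_sq_add_cos_sq Φ
      have p2 := sin_sq_add_cos_sq (x (m + 1))
      have c1 : cos (Φ + x (m + 1)) / sin (Φ + x (m + 1)) = cos (x (m + 1)) / sin (x (m + 1)) -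
          sin Φ / (sin (x (m + 1)) * sin (Φ + x (m + 1))) := by
        field_simp
        rw [cos_add, sin_add]
        linear_combination (-sin Φ) * p2
      have c2 : sin (Φ + x (m + 1)) / (sin Φ * sin (x (m + 1))) =
          cos Φ / sin Φ + cos (x (m + 1)) / sin (x (m + 1)) := by
        rw [sin_add]; field_simp; ring
      have c3 : (a * sin (Φ + x (m + 1)) - b * sin Φ) ^ 2 /
          (sin Φ * sin (x (m + 1)) * sin (Φ + x (m + 1))) =
          a ^ 2 * (sin (Φ + x (m + 1)) / (sin Φ * sin (x (m + 1)))) - 2 * a * b / sin (x (m + 1)) +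
          b ^ 2 * (sin Φ / (sin (x (m + 1)) * sin (Φ + x (m + 1)))) := by
        field_simp; ring
      rw [c3, c1, c2, vertexForm]
      field_simp; ring
    rw [hid]
    have hsq : 0 ≤ (a * sin (Φ + x (m + 1)) - b * sin Φ) ^ 2 /
          (sin Φ * sin (x (m + 1)) * sin (Φ + x (m + 1))) := by positivity
    refine ⟨by linarith, fun h => ?_⟩
    obtain ⟨μ, hμ⟩ := ih2 (by linarith)
    have hz : (a * sin (Φ + x (m + 1)) - b * sin Φ) ^ 2 /
          (sin Φ * sin (x (m + 1)) * sin (Φ + x (m + 1))) = 0 := by linarith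
    rw [div_eq_zero_iff, or_iff_left (by positivity), sq_eq_zero_iff] at hz
    refine ⟨μ, fun i hi => ?_⟩
    rcases Nat.of_le_succ hi with h' | rfl
    · exact hμ i h'
    · have ha : a = μ * sin Φ := hμ (m + 1) le_rfl
      have : b * sin Φ = (μ * sin (turning x (m + 1 + 1))) * sin Φ := by
        rw [hsucc]; rw [ha] at hz; linear_combination -hz
      exact mul_right_cancel₀ s1.ne' this

/-- A discrete Wirtinger inequality on an arc of length at most `π`. -/
theorem sum_vertexForm_le {x k : ℕ → ℝ} (hx : ∀ i, x i ∈ Ioo 0 π) {m : ℕ} (h0 : k 0 = 0)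
    (hkm : k m = 0) (hm : turning x m ≤ π) :
    ∑ i ∈ Finset.range m, vertexForm (x i) (k i) (k (i + 1)) ≤ 0 ∧
      (∑ i ∈ Finset.range m, vertexForm (x i) (k i) (k (i + 1)) = 0 →
        ∃ μ, ∀ i ≤ m, k i = μ * sin (turning x i)) := by
  rcases m with _ | m
  · refine ⟨by simp, fun _ => ⟨0, fun i hi => ?_⟩⟩
    rw [Nat.le_zero.1 hi, h0, zero_mul]
  rcases hm.lt_or_eq with hlt | heq
  · simpa [hkm] using sum_vertexForm_add_le hx h0 m hlt
  rcases m with _ | m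
  · have := (hx 0).2
    simp [turning] at heq
    linarith
  have hΦ : turning x (m + 1) < π := heq ▸ turning_strictMono hx (Nat.lt_succ_self (m + 1))
  obtain ⟨h1, h2⟩ := sum_vertexForm_add_le hx h0 m hΦ
  have hΦ' : turning x (m + 1) = π - x (m + 1) := by
    rw [turning_succ] at heq; linarith
  -- When the turning is exactly π, cot is unusable at the end point. The last vertex form is then
  -- itself the boundary term of the preceding arc.
  have hlast : vertexForm (x (m + 1)) (k (m + 1)) (k (m + 1 + 1)) =
      k (m + 1) ^ 2 * (cos (turning x (m + 1)) / sin (turning x (m + 1))) := by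
    rw [hΦ', cos_pi_sub, sin_pi_sub, vertexForm, hkm]; ring
  rw [Finset.sum_range_succ, hlast]
  refine ⟨h1, fun h => ?_⟩
  obtain ⟨μ, hμ⟩ := h2 h
  refine ⟨μ, fun i hi => ?_⟩
  rcases Nat.of_le_succ hi with h' | rfl
  · exact hμ i h'
  · rw [hkm, heq, sin_pi, mul_zero]

theorem halfCot_pi_sub {x : ℝ} (hx : x ∈ Ioo 0 π) : halfCot (π - x) = (1 - cos x) / sin x := by
  have h1 : sin x = 2 * sin (x / 2) * cos (x / 2) := by rw [← sin_two_mul]; ring_nf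
  have h2 : cos x = 2 * cos (x / 2) ^ 2 - 1 := by rw [← cos_two_mul]; ring_nf
  have hs : 0 < sin (x / 2) := sin_half_pos ⟨hx.1, hx.2.le⟩
  have hc : 0 < cos (x / 2) := cos_pos_of_mem_Ioo ⟨by linarith [hx.1, pi_pos], by linarith [hx.2]⟩
  have h3 := sin_sq_add_cos_sq (x / 2)
  rw [halfCot, show (π - x) / 2 = π / 2 - x / 2 by ring, cos_pi_div_two_sub, sin_pi_div_two_sub,
    h1, h2]
  field_simp
  linarith

theorem halfCot_pi_sub_pos {x : ℝ} (hx : x ∈ Ioo 0 π) : 0 < halfCot (π - x) := by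
  rw [halfCot, show (π - x) / 2 = π / 2 - x / 2 by ring, cos_pi_div_two_sub, sin_pi_div_two_sub]
  exact div_pos (sin_half_pos ⟨hx.1, hx.2.le⟩)
    (cos_pos_of_mem_Ioo ⟨by linarith [hx.1, pi_pos], by linarith [hx.2]⟩)

/-- The zeros at j and j + 1 kill the form at vertex j and leave two arcs, of turning at most π and
less than π, to which the Wirtinger inequality applies. Equality allows a multiple of sine on each
arc; the vanishing linear sum (the perimeter term) is needed because the first arc may turn by
exactly π. -/
theorem sum_vertexForm_closed_le {x k : ℕ → ℝ} (hx : ∀ i, x i ∈ Ioo 0 π) {n j : ℕ}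
    (hn : turning x n = 2 * π) (hjn : j < n) (hj : turning x j ≤ π) (hj' : π < turning x (j + 1))
    (h0 : k 0 = 0) (hkj : k j = 0) (hkj' : k (j + 1) = 0) (hkn : k n = 0) :
    ∑ i ∈ Finset.range n, vertexForm (x i) (k i) (k (i + 1)) ≤ 0 ∧
      (∑ i ∈ Finset.range n, vertexForm (x i) (k i) (k (i + 1)) = 0 →
        ∑ i ∈ Finset.range n, (k i + k (i + 1)) * halfCot (π - x i) = 0 → ∀ i ≤ n, k i = 0) := by
  obtain ⟨m, rfl⟩ := Nat.exists_eq_add_of_le (Nat.succ_le_of_lt hjn)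
  rw [Nat.succ_eq_add_one] at *
  obtain ⟨a1, a2⟩ := sum_vertexForm_le hx h0 hkj hj
  have hm : turning (fun i => x (j + 1 + i)) m < π := by
    have := turning_add x (j + 1) m
    linarith
  obtain ⟨b1, b2⟩ := sum_vertexForm_le (x := fun i => x (j + 1 + i)) (k := fun i => k (j + 1 + i))
    (fun i => hx _) (m := m) (by simpa using hkj') hkn hm.le
  have hsplit : ∑ i ∈ Finset.range (j + 1 + m), vertexForm (x i) (k i) (k (i + 1)) =
      ∑ i ∈ Finset.range j, vertexForm (x i) (k i) (k (i + 1)) +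
      ∑ i ∈ Finset.range m, vertexForm (x (j + 1 + i)) (k (j + 1 + i)) (k (j + 1 + (i + 1))) := by
    rw [Finset.sum_range_add, Finset.sum_range_succ, hkj, hkj']
    simp [vertexForm, add_assoc]
  rw [hsplit]
  refine ⟨by linarith, fun h hT => ?_⟩
  obtain ⟨μ, hμ⟩ := a2 (by linarith)
  obtain ⟨ν, hν⟩ := b2 (by linarith)
  -- The second arc turns by less than π, so the sine is positive at its end, where k vanishes;
  -- hence ν = 0.
  have hν0 : ∀ i, j + 1 ≤ i → i ≤ j + 1 + m → k i = 0 := by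
    intro i h1 h2
    obtain ⟨l, rfl⟩ := Nat.exists_eq_add_of_le h1
    rcases Nat.eq_zero_or_pos m with rfl | hm0
    · obtain rfl : l = 0 := by omega
      simpa using hkj'
    have hs : 0 < sin (turning (fun i => x (j + 1 + i)) m) :=
      sin_pos_of_pos_of_lt_pi (turning_pos (fun i => hx _) hm0) hm
    have h3 := hν m le_rfl
    simp only [hkn] at h3
    have : ν = 0 := by
      rcases mul_eq_zero.1 h3.symm with h | h
      · exact h
      · exact absurd h hs.ne'
    simpa [this] using hν l (by omega)
  -- Now k = μ s with s ≥ 0, and the half-angle cotangents are positive, so the linear condition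
  -- forces μ = 0 or s = 0.
  set s : ℕ → ℝ := fun i => if i ≤ j then sin (turning x i) else 0 with hs
  have hs0 : ∀ i, 0 ≤ s i := by
    intro i
    simp only [hs]
    split_ifs with hi
    · exact sin_nonneg_of_nonneg_of_le_pi
        (by simpa using (turning_strictMono hx).monotone (Nat.zero_le i))
        (((turning_strictMono hx).monotone hi).trans hj)
    · exact le_rfl
  have hks : ∀ i ≤ j + 1 + m, k i = μ * s i := by
    intro i hi
    simp only [hs]
    split_ifs with hij
    · exact hμ i hij
    · rw [mul_zero]; exact hν0 i (by omega) hi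
  have hT' : μ * ∑ i ∈ Finset.range (j + 1 + m), (s i + s (i + 1)) * halfCot (π - x i) = 0 := by
    rw [← hT, Finset.mul_sum]
    refine Finset.sum_congr rfl fun i hi => ?_
    rw [Finset.mem_range] at hi
    rw [hks i (by omega), hks (i + 1) (by omega)]; ring
  rcases mul_eq_zero.1 hT' with h1 | h1
  · intro i hi
    rw [hks i hi, h1, zero_mul]
  · rw [Finset.sum_eq_zero_iff_of_nonneg fun i _ =>
      mul_nonneg (add_nonneg (hs0 _) (hs0 _)) (halfCot_pi_sub_pos (hx i)).le] at h1
    intro i hi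
    rcases hi.lt_or_eq with hlt | rfl
    · rcases mul_eq_zero.1 (h1 i (Finset.mem_range.2 hlt)) with h2 | h2
      · rw [hks i hi, show s i = 0 by linarith [hs0 i, hs0 (i + 1)], mul_zero]
      · exact absurd h2 (halfCot_pi_sub_pos (hx i)).ne'
    · exact hkn

/-- A Steiner formula: shifting all support numbers by r adds the mixed term, which sums to the
perimeter, and the form of the polygon circumscribed about a circle of radius r. -/
theorem vertexForm_add {x : ℝ} (hx : x ∈ Ioo 0 π) (a b r : ℝ) :
    vertexForm x (a + r) (b + r) = vertexForm x a b + 2 * r * ((a + b) * halfCot (π - x)) +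
      2 * r ^ 2 * halfCot (π - x) := by
  have hs := (sin_pos_of_mem_Ioo hx).ne'
  rw [halfCot_pi_sub hx, vertexForm, vertexForm]
  field_simp; ring

/-- The isoperimetric inequality for closed sequences of support numbers. -/
theorem two_mul_sum_vertexForm_mul_le {x h : ℕ → ℝ} (hx : ∀ i, x i ∈ Ioo 0 π) {n j : ℕ} {r : ℝ}
    (hn : turning x n = 2 * π) (hjn : j < n) (hj : turning x j ≤ π) (hj' : π < turning x (j + 1))
    (h0 : h 0 = r) (hkj : h j = r) (hkj' : h (j + 1) = r) (hkn : h n = r) :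
    2 * (∑ i ∈ Finset.range n, vertexForm (x i) (h i) (h (i + 1))) *
        ∑ i ∈ Finset.range n, halfCot (π - x i) ≤
      (∑ i ∈ Finset.range n, (h i + h (i + 1)) * halfCot (π - x i)) ^ 2 ∧
    (2 * (∑ i ∈ Finset.range n, vertexForm (x i) (h i) (h (i + 1))) *
        ∑ i ∈ Finset.range n, halfCot (π - x i) =
      (∑ i ∈ Finset.range n, (h i + h (i + 1)) * halfCot (π - x i)) ^ 2 → ∀ i ≤ n, h i = r) := by
  obtain ⟨k, rfl⟩ : ∃ k : ℕ → ℝ, h = fun i => k i + r := ⟨fun i => h i - r, by simp⟩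
  simp only [add_eq_right] at h0 hkj hkj' hkn ⊢
  obtain ⟨q1, q2⟩ := sum_vertexForm_closed_le hx hn hjn hj hj' h0 hkj hkj' hkn
  set C := ∑ i ∈ Finset.range n, halfCot (π - x i) with hC
  set M := ∑ i ∈ Finset.range n, (k i + k (i + 1)) * halfCot (π - x i) with hM
  set Q := ∑ i ∈ Finset.range n, vertexForm (x i) (k i) (k (i + 1)) with hQ
  have hCpos : 0 < C :=
    Finset.sum_pos (fun i _ => halfCot_pi_sub_pos (hx i)) ⟨j, Finset.mem_range.2 hjn⟩
  have e1 : ∑ i ∈ Finset.range n, vertexForm (x i) (k i + r) (k (i + 1) + r) =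
      Q + 2 * r * M + 2 * r ^ 2 * C := by
    simp only [vertexForm_add (hx _), Finset.sum_add_distrib, ← Finset.mul_sum]
    rfl
  have e2 : ∑ i ∈ Finset.range n, (k i + r + (k (i + 1) + r)) * halfCot (π - x i) =
      M + 2 * r * C := by
    rw [hM, hC, Finset.mul_sum, ← Finset.sum_add_distrib]
    exact Finset.sum_congr rfl fun i _ => by ring
  rw [e1, e2]
  -- After expansion in r, the right side minus the left is M² - 2QC, free of r. So the sign of r is
  -- irrelevant, and equality forces M = 0 and Q = 0.
  have hQC : Q * C ≤ 0 := mul_nonpos_of_nonpos_of_nonneg q1 hCpos.le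
  refine ⟨by nlinarith [sq_nonneg M], fun h => ?_⟩
  have h1 : M ^ 2 = 2 * (Q * C) := by linear_combination -h
  have h2 : M ^ 2 = 0 := le_antisymm (by linarith) (sq_nonneg M)
  have h3 : Q * C = 0 := by linarith
  exact q2 ((mul_eq_zero.1 h3).resolve_right hCpos.ne') (pow_eq_zero_iff two_ne_zero |>.1 h2)

/-- Some circle touches any three lines with pairwise distinct directions. -/
theorem exists_tritangent (u v w : ℝ) {a b : ℝ} (ha : 0 < a) (hab : a < b) (hb : b < 2 * π) :
    ∃ r p q : ℝ, u = r + p ∧ v = r + p * cos a + q * sin a ∧ w = r + p * cos b + q * sin b := by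
  -- The determinant of the linear system for p and q once r is eliminated; it factors into
  -- half-angle sines.
  have hD : (cos a - 1) * sin b - (cos b - 1) * sin a ≠ 0 := by
    have ea : sin a = 2 * sin (a / 2) * cos (a / 2) := by rw [← sin_two_mul]; ring_nf
    have eb : sin b = 2 * sin (b / 2) * cos (b / 2) := by rw [← sin_two_mul]; ring_nf
    have ca : cos a = 1 - 2 * sin (a / 2) ^ 2 := by rw [← cos_two_mul_eq_one_sub]; ring_nf
    have cb : cos b = 1 - 2 * sin (b / 2) ^ 2 := by rw [← cos_two_mul_eq_one_sub]; ring_nf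
    have : (cos a - 1) * sin b - (cos b - 1) * sin a =
        4 * sin (a / 2) * sin (b / 2) * sin (b / 2 - a / 2) := by
      rw [sin_sub, ea, eb, ca, cb]; ring
    rw [this]
    have s1 : 0 < sin (a / 2) := sin_pos_of_pos_of_lt_pi (by linarith) (by linarith)
    have s2 : 0 < sin (b / 2) := sin_pos_of_pos_of_lt_pi (by linarith) (by linarith)
    have s3 : 0 < sin (b / 2 - a / 2) := sin_pos_of_pos_of_lt_pi (by linarith) (by linarith)
    positivity
  set D := (cos a - 1) * sin b - (cos b - 1) * sin a with hDdef
  set p := ((v - u) * sin b - (w - u) * sin a) / D with hp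
  set q := ((cos a - 1) * (w - u) - (cos b - 1) * (v - u)) / D with hq
  have hp' : p * D = (v - u) * sin b - (w - u) * sin a := div_mul_cancel₀ _ hD
  have hq' : q * D = (cos a - 1) * (w - u) - (cos b - 1) * (v - u) := div_mul_cancel₀ _ hD
  refine ⟨u - p, p, q, by ring, mul_right_cancel₀ hD ?_, mul_right_cancel₀ hD ?_⟩
  · linear_combination (1 - cos a) * hp' - sin a * hq' + (v - u) * hDdef
  · linear_combination (1 - cos b) * hp' - sin b * hq' + (w - u) * hDdef

/-! ### Convex closed sequences of points -/

/-- The unit vector with a given direction angle. -/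
def dirVec (t : ℝ) : Plane := !₂[cos t, sin t]

@[simp] theorem dirVec_zero (t : ℝ) : dirVec t 0 = cos t := rfl
@[simp] theorem dirVec_one (t : ℝ) : dirVec t 1 = sin t := rfl

theorem plane_ext {u v : Plane} (h0 : u 0 = v 0) (h1 : u 1 = v 1) : u = v := by
  ext i; fin_cases i <;> assumption

theorem plane_inner (u v : Plane) : inner ℝ u v = u 0 * v 0 + u 1 * v 1 := by
  simp [PiLp.inner_apply, Fin.sum_univ_two, mul_comm]

theorem plane_norm_sq (u : Plane) : ‖u‖ ^ 2 = u 0 ^ 2 + u 1 ^ 2 := by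
  rw [← real_inner_self_eq_norm_sq, plane_inner]; ring

theorem planeCross_sq_add_inner_sq (u v : Plane) :
    planeCross u v ^ 2 + inner ℝ u v ^ 2 = (‖u‖ * ‖v‖) ^ 2 := by
  rw [mul_pow, plane_norm_sq, plane_norm_sq, plane_inner, planeCross]; ring

theorem norm_dirVec (t : ℝ) : ‖dirVec t‖ = 1 := by
  have := plane_norm_sq (dirVec t)
  simp only [dirVec_zero, dirVec_one, cos_sq_add_sin_sq] at this
  exact (pow_eq_one_iff_of_nonneg (norm_nonneg _) two_ne_zero).1 this

theorem exists_eq_norm_smul_dirVec {u : Plane} (hu : u ≠ 0) : ∃ t, u = ‖u‖ • dirVec t := by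
  have h0 : ‖u‖ ≠ 0 := norm_ne_zero_iff.2 hu
  set z : ℂ := ⟨u 0, u 1⟩ with hz
  have hzn : ‖z‖ = ‖u‖ := by
    rw [← sq_eq_sq₀ (norm_nonneg _) (norm_nonneg _), plane_norm_sq, Complex.sq_norm,
      Complex.normSq_apply]
    ring
  have hz0 : z ≠ 0 := norm_ne_zero_iff.1 (hzn ▸ h0)
  refine ⟨Complex.arg z, plane_ext ?_ ?_⟩
  · simp [Complex.cos_arg hz0, hzn]; field_simp; rfl
  · simp [Complex.sin_arg, hzn]; field_simp; rfl

theorem sin_angle_of_planeCross_pos {u v : Plane} (h : 0 < planeCross u v) :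
    planeCross u v = ‖u‖ * ‖v‖ * sin (InnerProductGeometry.angle u v) := by
  have h1 := InnerProductGeometry.cos_angle_mul_norm_mul_norm u v
  have h2 := planeCross_sq_add_inner_sq u v
  have h3 := sin_sq_add_cos_sq (InnerProductGeometry.angle u v)
  have h4 := InnerProductGeometry.sin_angle_nonneg u v
  rw [← sq_eq_sq₀ h.le (by positivity)]
  linear_combination h2 + (‖u‖ * ‖v‖) ^ 2 * (-h3) -
    (inner ℝ u v + cos (InnerProductGeometry.angle u v) * (‖u‖ * ‖v‖)) * (-h1)

theorem angle_mem_Ioo_of_planeCross_pos {u v : Plane} (h : 0 < planeCross u v) :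
    InnerProductGeometry.angle u v ∈ Ioo 0 π := by
  have h1 := sin_angle_of_planeCross_pos h
  have h2 : sin (InnerProductGeometry.angle u v) ≠ 0 := by
    intro h0; rw [h0, mul_zero] at h1; exact h.ne' h1
  refine ⟨lt_of_le_of_ne (InnerProductGeometry.angle_nonneg _ _) ?_,
    lt_of_le_of_ne (InnerProductGeometry.angle_le_pi _ _) ?_⟩
  · intro h0; rw [← h0, sin_zero] at h2; exact h2 rfl
  · intro h0; rw [h0, sin_pi] at h2; exact h2 rfl

theorem eq_norm_smul_dirVec_add_angle {u v : Plane} (h : 0 < planeCross u v) {t : ℝ}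
    (hu : u = ‖u‖ • dirVec t) : v = ‖v‖ • dirVec (t + InnerProductGeometry.angle u v) := by
  have hu0 : ‖u‖ ≠ 0 := by
    intro h0; rw [norm_eq_zero] at h0; simp [h0, planeCross] at h
  have h1 := InnerProductGeometry.cos_angle_mul_norm_mul_norm u v
  have h2 := sin_angle_of_planeCross_pos h
  rw [plane_inner] at h1
  rw [planeCross] at h2
  set θ := InnerProductGeometry.angle u v
  set a := ‖u‖
  have e0 : u 0 = a * cos t := by rw [hu]; simp
  have e1 : u 1 = a * sin t := by rw [hu]; simp
  rw [e0, e1] at h1 h2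
  have h1' : cos θ * ‖v‖ = cos t * v 0 + sin t * v 1 :=
    mul_left_cancel₀ hu0 (by linear_combination h1)
  have h2' : cos t * v 1 - sin t * v 0 = ‖v‖ * sin θ :=
    mul_left_cancel₀ hu0 (by linear_combination h2)
  have hsc := sin_sq_add_cos_sq t
  apply plane_ext
  · simp only [PiLp.smul_apply, dirVec_zero, smul_eq_mul, cos_add]
    linear_combination (-cos t) * h1' + (-sin t) * h2' - v 0 * hsc
  · simp only [PiLp.smul_apply, dirVec_one, smul_eq_mul, sin_add]
    linear_combination (-sin t) * h1' + (cos t) * h2' - v 1 * hsc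

/-- An `n`-periodic sequence of points that runs counterclockwise through the vertices of a convex
polygon. -/
structure IsConvexSeq (n : ℕ) (V : ℕ → Plane) : Prop where
  three_le : 3 ≤ n
  periodic : ∀ i, V (i + n) = V i
  left : ∀ i k, ¬ k ≡ i [MOD n] → ¬ k ≡ i + 1 [MOD n] →
    0 < planeCross (V (i + 1) - V i) (V k - V i)

/-- The exterior angle between two consecutive edges. -/
def extAngle (V : ℕ → Plane) (i : ℕ) : ℝ :=
  InnerProductGeometry.angle (V (i + 1) - V i) (V (i + 1 + 1) - V (i + 1))

namespace IsConvexSeq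

variable {n : ℕ} {V : ℕ → Plane}

theorem not_modEq {n a b : ℕ} (h1 : a < b) (h2 : b < a + n) : ¬ b ≡ a [MOD n] := by
  intro h
  have := (Nat.modEq_iff_dvd' h1.le).1 h.symm
  have := Nat.le_of_dvd (by omega) this
  omega

theorem left_nonneg (hV : IsConvexSeq n V) (i k : ℕ) :
    0 ≤ planeCross (V (i + 1) - V i) (V k - V i) := by
  have hp : ∀ {a b : ℕ}, a ≡ b [MOD n] → V a = V b := fun {a b} h => by
    have : Function.Periodic V n := hV.periodic
    rw [← this.map_mod_nat a, ← this.map_mod_nat b, h]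
  by_cases h1 : k ≡ i [MOD n]
  · rw [hp h1]; simp [planeCross]
  by_cases h2 : k ≡ i + 1 [MOD n]
  · rw [hp h2]; simp [planeCross]; linarith
  exact (hV.left i k h1 h2).le

theorem cross_edge_pos (hV : IsConvexSeq n V) (i : ℕ) :
    0 < planeCross (V (i + 1) - V i) (V (i + 1 + 1) - V (i + 1)) := by
  have h3 := hV.three_le
  have := hV.left i (i + 1 + 1) (not_modEq (by omega) (by omega)) (not_modEq (by omega) (by omega))
  simp only [planeCross, PiLp.sub_apply] at this ⊢
  linarith

theorem edge_ne_zero (hV : IsConvexSeq n V) (i : ℕ) : V (i + 1) - V i ≠ 0 := by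
  intro h
  have := hV.cross_edge_pos i
  simp [h, planeCross] at this

theorem norm_edge_pos (hV : IsConvexSeq n V) (i : ℕ) : 0 < ‖V (i + 1) - V i‖ :=
  norm_pos_iff.2 (hV.edge_ne_zero i)

theorem extAngle_mem (hV : IsConvexSeq n V) (i : ℕ) : extAngle V i ∈ Ioo 0 π :=
  angle_mem_Ioo_of_planeCross_pos (hV.cross_edge_pos i)

theorem exists_polar (hV : IsConvexSeq n V) : ∃ t, ∀ i,
    V (i + 1) - V i = ‖V (i + 1) - V i‖ • dirVec (t + turning (extAngle V) i) := by
  obtain ⟨t, ht⟩ := exists_eq_norm_smul_dirVec (hV.edge_ne_zero 0)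
  refine ⟨t, fun i => ?_⟩
  induction i with
  | zero => simpa using ht
  | succ i ih =>
    rw [turning_succ, ← add_assoc]
    exact eq_norm_smul_dirVec_add_angle (hV.cross_edge_pos i) ih

/-- Let e and f be the two consecutive edges. Expanding V 0 - V (k + 1) in e and f, with
coefficients whose signs are known as V 0 is to the left of both, expresses the height of V (k + 1)
over the first edge. A fall followed by a rise would make that height nonpositive. -/
theorem not_local_min (hV : IsConvexSeq n V) {k : ℕ} (h1 : 1 ≤ k) (h2 : k + 1 < n)
    (ha : planeCross (V 1 - V 0) (V (k + 1) - V k) ≤ 0) :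
    planeCross (V 1 - V 0) (V (k + 1 + 1) - V (k + 1)) < 0 := by
  by_contra! hb
  have hD := hV.cross_edge_pos k
  have hs := hV.left_nonneg k 0
  have ht := hV.left_nonneg (k + 1) 0
  have hpos := hV.left 0 (k + 1) (not_modEq (by omega) (by omega)) (not_modEq (by omega) (by omega))
  simp only [planeCross, PiLp.sub_apply, zero_add] at *
  have key := add_nonneg (mul_nonneg hs hb) (mul_nonneg ht (neg_nonneg.2 ha))
  have := mul_pos hD hpos
  linarith

/-- The sine of the turning angle tells whether an edge rises or falls relative to the first one.
Once the edges stop rising they keep falling, so the angle cannot reach 2π before the last turn,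
which is below π. Closing up makes the total a multiple of 2π. -/
theorem turning_eq_two_pi (hV : IsConvexSeq n V) : turning (extAngle V) n = 2 * π := by
  obtain ⟨t, ht⟩ := hV.exists_polar
  have h3 := hV.three_le
  set Φ := turning (extAngle V) with hΦ
  have hx := hV.extAngle_mem
  have hcross : ∀ k, planeCross (V 1 - V 0) (V (k + 1) - V k) =
      ‖V 1 - V 0‖ * ‖V (k + 1) - V k‖ * sin (Φ k) := by
    intro k
    have h0 := ht 0
    simp only [hΦ, turning_zero, zero_add, add_zero] at h0
    have e : sin (Φ k) = sin (t + Φ k) * cos t - cos (t + Φ k) * sin t := by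
      rw [← sin_sub]; ring_nf
    rw [planeCross, ht k, h0]
    simp only [PiLp.smul_apply, dirVec_zero, dirVec_one, smul_eq_mul, norm_smul, norm_dirVec,
      norm_norm, mul_one]
    rw [e]; ring
  have hlt : ∀ k, k + 1 < n → Φ (k + 1) < 2 * π := by
    intro k
    induction k with
    | zero =>
      intro _
      have := (hx 0).2
      simp only [hΦ, zero_add, turning, Finset.range_one, Finset.sum_singleton]
      linarith [pi_pos]
    | succ k ih =>
      intro hk
      have ih' := ih (by omega)
      have hs := turning_succ (extAngle V) (k + 1)
      rw [← hΦ] at hs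
      have hxk := hx (k + 1)
      rcases lt_or_ge (Φ (k + 1)) π with hlt | hge
      · linarith [hxk.2]
      · have h1 := hV.norm_edge_pos 0
        have h2 := hV.norm_edge_pos (k + 1)
        have h4 := hV.norm_edge_pos (k + 1 + 1)
        have hneg : planeCross (V 1 - V 0) (V (k + 1 + 1) - V (k + 1)) ≤ 0 := by
          rw [hcross]
          apply mul_nonpos_of_nonneg_of_nonpos (by positivity)
          have : 0 ≤ sin (Φ (k + 1) - π) :=
            sin_nonneg_of_nonneg_of_le_pi (by linarith) (by linarith)
          rw [sin_sub_pi] at this; linarith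
        have hneg' := hV.not_local_min (by omega) hk hneg
        rw [hcross] at hneg'
        by_contra! hcon
        have : 0 ≤ sin (Φ (k + 1 + 1) - 2 * π) :=
          sin_nonneg_of_nonneg_of_le_pi (by linarith) (by linarith [hxk.2])
        rw [sin_sub_two_pi] at this
        have : 0 ≤ ‖V 1 - V 0‖ * ‖V (k + 1 + 1 + 1) - V (k + 1 + 1)‖ * sin (Φ (k + 1 + 1)) := by
          positivity
        linarith
  obtain ⟨m, rfl⟩ : ∃ m, n = m + 1 + 1 := ⟨n - 2, by omega⟩
  have hlast := hlt m (by omega)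
  have hs := turning_succ (extAngle V) (m + 1)
  rw [← hΦ] at hs
  have hub : Φ (m + 1 + 1) < 4 * π := by linarith [(hx (m + 1)).2, pi_pos]
  have hlb : 0 < Φ (m + 1 + 1) := turning_pos hx (by omega)
  have hcos : cos (Φ (m + 1 + 1)) = 1 := by
    have h0 := ht 0
    have h1 := ht (m + 1 + 1)
    have p0 := hV.periodic 0
    have p1 := hV.periodic 1
    rw [zero_add] at p0
    rw [add_comm] at p1
    rw [p0, p1] at h1
    have hΦ0 : Φ 0 = 0 := turning_zero _
    simp only [hΦ0, zero_add, add_zero] at h0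
    have hne := hV.norm_edge_pos 0
    rw [zero_add] at hne
    have h2 : dirVec t = dirVec (t + Φ (m + 1 + 1)) :=
      smul_right_injective Plane hne.ne' (h0.symm.trans h1)
    have c0 : cos t = cos (t + Φ (m + 1 + 1)) := congrArg (fun v : Plane => v 0) h2
    have c1 : sin t = sin (t + Φ (m + 1 + 1)) := congrArg (fun v : Plane => v 1) h2
    have e : cos (Φ (m + 1 + 1)) = cos (t + Φ (m + 1 + 1)) * cos t +
        sin (t + Φ (m + 1 + 1)) * sin t := by
      rw [← cos_sub]; ring_nf
    rw [e, ← c0, ← c1]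
    linarith [sin_sq_add_cos_sq t]
  obtain ⟨l, hl⟩ := (cos_eq_one_iff _).1 hcos
  have hl0 : (0 : ℝ) < l := by
    by_contra! h
    have := mul_nonpos_of_nonpos_of_nonneg h two_pi_pos.le
    linarith
  have hl2 : (l : ℝ) < 2 := by
    by_contra! h
    have := mul_le_mul_of_nonneg_right h two_pi_pos.le
    linarith
  have : l = 1 := by
    have a1 : 0 < l := by exact_mod_cast hl0
    have a2 : l < 2 := by exact_mod_cast hl2
    omega
  rw [← hl, this]; simp

end IsConvexSeq

theorem exists_turning_crossing {x : ℕ → ℝ} {n : ℕ} (hn : turning x n = 2 * π) :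
    ∃ j < n, turning x j ≤ π ∧ π < turning x (j + 1) := by
  have hex : ∃ m, π < turning x m := ⟨n, by rw [hn]; linarith [pi_pos]⟩
  classical
  have h0 : Nat.find hex ≠ 0 := by
    intro h
    have := Nat.find_spec hex
    rw [h, turning_zero] at this
    linarith [pi_pos]
  have hle : Nat.find hex ≤ n := Nat.find_min' hex (by rw [hn]; linarith [pi_pos])
  obtain ⟨j, hj⟩ := Nat.exists_eq_succ_of_ne_zero h0
  refine ⟨j, by omega, ?_, ?_⟩
  · exact not_lt.1 (Nat.find_min hex (m := j) (by omega))
  · rw [← Nat.succ_eq_add_one, ← hj]; exact Nat.find_spec hex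

/-- The perimeter of a closed sequence of points. -/
def seqPerimeter (n : ℕ) (V : ℕ → Plane) : ℝ := ∑ i ∈ Finset.range n, ‖V (i + 1) - V i‖

/-- Twice the oriented area bounded by a closed sequence of points. -/
def seqDoubleArea (n : ℕ) (V : ℕ → Plane) (c : Plane) : ℝ :=
  ∑ i ∈ Finset.range n, planeCross (V i - c) (V (i + 1) - c)

/-- The sum of the half-angle cotangents of the interior angles. -/
def seqCotSum (n : ℕ) (V : ℕ → Plane) : ℝ := ∑ i ∈ Finset.range n, halfCot (π - extAngle V i)

/-- All edges of the sequence are at signed distance `r` from the point `c`. -/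
def IsInscribed (V : ℕ → Plane) (c : Plane) (r : ℝ) : Prop :=
  ∀ i, planeCross (V i - c) (V (i + 1) - V i) = r * ‖V (i + 1) - V i‖

theorem IsInscribed.doubleArea_eq {V : ℕ → Plane} {c : Plane} {r : ℝ}
    (h : IsInscribed V c r) (n : ℕ) : seqDoubleArea n V c = r * seqPerimeter n V := by
  rw [seqPerimeter, seqDoubleArea, Finset.mul_sum]
  refine Finset.sum_congr rfl fun i _ => ?_
  rw [← h i]
  simp only [planeCross, PiLp.sub_apply]
  ring

/-! ### Support numbers and L'Huilier's inequality -/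

namespace IsConvexSeq

variable {n : ℕ} {V : ℕ → Plane}

/-- Moving the base point changes the summands by a telescoping difference. -/
theorem seqDoubleArea_eq (hV : IsConvexSeq n V) (c c' : Plane) :
    seqDoubleArea n V c = seqDoubleArea n V c' := by
  have h := Finset.sum_range_sub (fun i => planeCross (c' - c) (V i)) n
  have hp := hV.periodic 0
  rw [zero_add] at hp
  rw [hp, sub_self] at h
  rw [← sub_eq_zero, ← h, seqDoubleArea, seqDoubleArea, ← Finset.sum_sub_distrib]
  refine Finset.sum_congr rfl fun i _ => ?_
  simp only [planeCross, PiLp.sub_apply]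
  ring

theorem extAngle_periodic (hV : IsConvexSeq n V) (i : ℕ) : extAngle V (i + n) = extAngle V i := by
  have e : ∀ a b : ℕ, a + n + b = a + b + n := fun a b => by omega
  simp only [extAngle, e, hV.periodic]

/-- The lengths of the edges in terms of the support numbers. -/
theorem support_sums (hV : IsConvexSeq n V) {t : ℝ} (ht : ∀ i,
    V (i + 1) - V i = ‖V (i + 1) - V i‖ • dirVec (t + turning (extAngle V) i)) (c : Plane) :
    seqPerimeter n V = ∑ i ∈ Finset.range n,
      (planeCross (V i - c) (dirVec (t + turning (extAngle V) i)) +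
        planeCross (V (i + 1) - c) (dirVec (t + turning (extAngle V) (i + 1)))) *
        halfCot (π - extAngle V i) ∧
    seqDoubleArea n V c = ∑ i ∈ Finset.range n, vertexForm (extAngle V i)
      (planeCross (V i - c) (dirVec (t + turning (extAngle V) i)))
      (planeCross (V (i + 1) - c) (dirVec (t + turning (extAngle V) (i + 1)))) := by
  set ψ : ℕ → ℝ := fun i => t + turning (extAngle V) i with hψ
  change (∀ i, V (i + 1) - V i = ‖V (i + 1) - V i‖ • dirVec (ψ i)) at ht
  set h : ℕ → ℝ := fun i => planeCross (V i - c) (dirVec (ψ i)) with hh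
  set b : ℕ → ℝ := fun i => inner ℝ (V i - c) (dirVec (ψ i)) with hb
  have hψs : ∀ i, ψ (i + 1) = ψ i + extAngle V i := fun i => by
    simp only [hψ, turning_succ]; ring
  have hp := hV.periodic 0
  rw [zero_add] at hp
  have hdir : dirVec (ψ n) = dirVec (ψ 0) := by
    simp only [hψ, hV.turning_eq_two_pi, turning_zero, add_zero, dirVec, cos_add_two_pi,
      sin_add_two_pi]
  have hbn : b n = b 0 := by simp only [hb, hp, hdir]
  have hhn : h n = h 0 := by simp only [hh, hp, hdir]
  have tele : ∀ f : ℕ → ℝ, f n = f 0 → ∑ i ∈ Finset.range n, (f (i + 1) - f i) = 0 := fun f hf => by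
    rw [Finset.sum_range_sub, hf, sub_self]
  -- The sums are regrouped by vertices: `b i + l` and `b (i + 1)` are the coordinates of V (i + 1)
  -- along its two edges, which both support numbers determine. The added differences telescope to 0
  -- around the polygon.
  have vert : ∀ i, ‖V (i + 1) - V i‖ + (b i - b (i + 1)) =
        (h i + h (i + 1)) * halfCot (π - extAngle V i) ∧
      planeCross (V i - c) (V (i + 1) - c) + (h i * b i - h (i + 1) * b (i + 1)) =
        vertexForm (extAngle V i) (h i) (h (i + 1)) := by
    intro i
    set x := extAngle V i with hx
    have hxI : x ∈ Ioo 0 π := hV.extAngle_mem i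
    have hs : sin x ≠ 0 := (sin_pos_of_mem_Ioo hxI).ne'
    set l := ‖V (i + 1) - V i‖ with hl
    have k0 : V (i + 1) 0 - V i 0 = l * cos (ψ i) := by
      have := congrArg (fun v : Plane => v 0) (ht i); simpa using this
    have k1 : V (i + 1) 1 - V i 1 = l * sin (ψ i) := by
      have := congrArg (fun v : Plane => v 1) (ht i); simpa using this
    have p1 := sin_sq_add_cos_sq (ψ i)
    have p2 := sin_sq_add_cos_sq x
    have E1 : b i + l = inner ℝ (V (i + 1) - c) (dirVec (ψ i)) := by
      simp only [hb, plane_inner, PiLp.sub_apply, dirVec_zero, dirVec_one]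
      linear_combination (-cos (ψ i)) * k0 + (-sin (ψ i)) * k1 - l * p1
    have E2 : h i = planeCross (V (i + 1) - c) (dirVec (ψ i)) := by
      simp only [hh, planeCross, PiLp.sub_apply, dirVec_zero, dirVec_one]
      linear_combination (-sin (ψ i)) * k0 + cos (ψ i) * k1
    have E3 : (b i + l) * sin x = h (i + 1) - h i * cos x := by
      rw [E1, E2]
      simp only [hh, hψs, ← hx, plane_inner, planeCross, PiLp.sub_apply, dirVec_zero, dirVec_one,
        cos_add, sin_add]
      ring
    have E4 : b (i + 1) * sin x = h (i + 1) * cos x - h i := by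
      rw [E2]
      simp only [hh, hb, hψs, ← hx, plane_inner, planeCross, PiLp.sub_apply, dirVec_zero,
        dirVec_one, cos_add, sin_add]
      linear_combination ((V (i + 1) 0 - c 0) * sin (ψ i) - (V (i + 1) 1 - c 1) * cos (ψ i)) *
        (-p2)
    have E5 : planeCross (V i - c) (V (i + 1) - c) = h i * l := by
      simp only [hh, planeCross, PiLp.sub_apply, dirVec_zero, dirVec_one]
      linear_combination (V i 0 - c 0) * k1 - (V i 1 - c 1) * k0
    have a1 : b i + l = (h (i + 1) - h i * cos x) / sin x := by rw [← E3]; field_simp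
    have a2 : b (i + 1) = (h (i + 1) * cos x - h i) / sin x := by rw [← E4]; field_simp
    constructor
    · rw [halfCot_pi_sub hxI]
      have : l + (b i - b (i + 1)) = (b i + l) - b (i + 1) := by ring
      rw [this, a1, a2]; field_simp; ring
    · have : planeCross (V i - c) (V (i + 1) - c) + (h i * b i - h (i + 1) * b (i + 1)) =
          h i * (b i + l) - h (i + 1) * b (i + 1) := by rw [E5]; ring
      rw [this, a1, a2, vertexForm]; field_simp; ring
  have t1 := tele b hbn
  have t2 := tele (fun i => h i * b i) (by simp only [hbn, hhn])
  constructor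
  · rw [← Finset.sum_congr rfl fun i _ => (vert i).1, Finset.sum_add_distrib, seqPerimeter]
    have : ∑ i ∈ Finset.range n, (b i - b (i + 1)) = 0 := by
      rw [← neg_eq_zero, ← Finset.sum_neg_distrib, ← t1]
      exact Finset.sum_congr rfl fun i _ => by ring
    rw [this, add_zero]
  · rw [← Finset.sum_congr rfl fun i _ => (vert i).2, Finset.sum_add_distrib, seqDoubleArea]
    have : ∑ i ∈ Finset.range n, (h i * b i - h (i + 1) * b (i + 1)) = 0 := by
      rw [← neg_eq_zero, ← Finset.sum_neg_distrib, ← t2]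
      exact Finset.sum_congr rfl fun i _ => by ring
    rw [this, add_zero]

theorem seqCotSum_pos (hV : IsConvexSeq n V) : 0 < seqCotSum n V :=
  Finset.sum_pos (fun i _ => halfCot_pi_sub_pos (hV.extAngle_mem i))
    ⟨0, Finset.mem_range.2 (by linarith [hV.three_le])⟩

theorem seqPerimeter_pos (hV : IsConvexSeq n V) : 0 < seqPerimeter n V :=
  Finset.sum_pos (fun i _ => hV.norm_edge_pos i)
    ⟨0, Finset.mem_range.2 (by linarith [hV.three_le])⟩

theorem isInscribed_iff {t : ℝ} (hV : IsConvexSeq n V) (ht : ∀ i,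
    V (i + 1) - V i = ‖V (i + 1) - V i‖ • dirVec (t + turning (extAngle V) i)) (c : Plane) (r : ℝ)
    (i : ℕ) : planeCross (V i - c) (V (i + 1) - V i) = r * ‖V (i + 1) - V i‖ ↔
      planeCross (V i - c) (dirVec (t + turning (extAngle V) i)) = r := by
  have h := hV.norm_edge_pos i
  have e : planeCross (V i - c) (V (i + 1) - V i) =
      planeCross (V i - c) (dirVec (t + turning (extAngle V) i)) * ‖V (i + 1) - V i‖ := by
    conv_lhs => rw [ht i]
    simp only [planeCross, PiLp.smul_apply, smul_eq_mul]; ring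
  rw [e, mul_left_inj' h.ne']

theorem perimeter_of_isInscribed (hV : IsConvexSeq n V) {c : Plane} {r : ℝ}
    (h : IsInscribed V c r) : seqPerimeter n V = 2 * r * seqCotSum n V := by
  obtain ⟨t, ht⟩ := hV.exists_polar
  rw [(hV.support_sums ht c).1, seqCotSum, Finset.mul_sum]
  refine Finset.sum_congr rfl fun i _ => ?_
  rw [(hV.isInscribed_iff ht c r i).1 (h i), (hV.isInscribed_iff ht c r (i + 1)).1 (h (i + 1))]
  ring

/-- L'Huilier's inequality with its equality case. -/
theorem two_mul_doubleArea_mul_cotSum_le (hV : IsConvexSeq n V) (c : Plane) :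
    2 * seqDoubleArea n V c * seqCotSum n V ≤ seqPerimeter n V ^ 2 ∧
      (2 * seqDoubleArea n V c * seqCotSum n V = seqPerimeter n V ^ 2 →
        ∃ c r, 0 < r ∧ IsInscribed V c r) := by
  obtain ⟨t, ht⟩ := hV.exists_polar
  set Φ := turning (extAngle V) with hΦ
  have hx := hV.extAngle_mem
  have hmono := turning_strictMono hx
  have hn := hV.turning_eq_two_pi
  obtain ⟨j, hjn, hj, hj'⟩ := exists_turning_crossing hn
  have hj0 : 0 < Φ j := by
    rcases Nat.eq_zero_or_pos j with rfl | h
    · have := (hx 0).2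
      simp [turning] at hj'
      linarith
    · exact turning_pos hx h
  have hj1 : Φ (j + 1) < 2 * π := by
    rw [← hn]
    refine hmono (lt_of_le_of_ne hjn fun h => ?_)
    have h1 := turning_succ (extAngle V) j
    rw [h, hn] at h1
    linarith [(hx j).2]
  set h : ℕ → ℝ := fun i => planeCross (V i) (dirVec (t + Φ i)) with hh
  -- The sides 0, j and j + 1 get equal support numbers r after a change of origin. Here r is
  -- signed, and its sign is settled only in the equality case.
  obtain ⟨r, p, q, e0, e1, e2⟩ := exists_tritangent (h 0) (h j) (h (j + 1)) hj0
    (hmono (Nat.lt_succ_self j)) hj1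
  -- Chosen so that its own support number in direction t + Φ is p cos Φ + q sin Φ.
  set c' : Plane := !₂[q * cos t + p * sin t, q * sin t - p * cos t] with hc'
  have hcc : ∀ i, planeCross (V i - c') (dirVec (t + Φ i)) =
      h i - (p * cos (Φ i) + q * sin (Φ i)) := by
    intro i
    have c0 : c' 0 = q * cos t + p * sin t := rfl
    have c1 : c' 1 = q * sin t - p * cos t := rfl
    simp only [hh, planeCross, PiLp.sub_apply, dirVec_zero, dirVec_one, c0, c1, cos_add, sin_add]
    linear_combination (-(p * cos (Φ i) + q * sin (Φ i))) * sin_sq_add_cos_sq t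
  rw [hV.seqDoubleArea_eq c c', (hV.support_sums ht c').1, (hV.support_sums ht c').2]
  have h0 : planeCross (V 0 - c') (dirVec (t + Φ 0)) = r := by
    rw [hcc, e0, hΦ, turning_zero]; simp
  have hnr : planeCross (V n - c') (dirVec (t + Φ n)) = r := by
    have hp := hV.periodic 0
    rw [zero_add] at hp
    rw [← h0, hΦ, hn, turning_zero, hp]
    simp [dirVec]
  obtain ⟨m1, m2⟩ := two_mul_sum_vertexForm_mul_le
    (h := fun i => planeCross (V i - c') (dirVec (t + Φ i))) hx hn hjn hj hj' h0
    (by rw [hcc, e1]; ring) (by rw [hcc, e2]; ring) hnr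
  refine ⟨m1, fun heq => ?_⟩
  have hall := m2 heq
  have hins : IsInscribed V c' r := by
    have hlt : ∀ i < n, planeCross (V i - c') (V (i + 1) - V i) = r * ‖V (i + 1) - V i‖ :=
      fun i hi => (hV.isInscribed_iff ht c' r i).2 (hall i hi.le)
    intro i
    have hper : Function.Periodic V n := hV.periodic
    have hmod : V (i % n + 1) = V (i + 1) := by
      rw [← hper.map_mod_nat (i + 1), ← hper.map_mod_nat (i % n + 1), Nat.mod_add_mod]
    have := hlt (i % n) (Nat.mod_lt _ (by omega))
    rwa [hmod, hper.map_mod_nat] at this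
  refine ⟨c', r, ?_, hins⟩
  have h1 := hV.perimeter_of_isInscribed hins
  have h2 := hV.seqPerimeter_pos
  rw [h1] at h2
  by_contra! hr
  have := mul_nonpos_of_nonpos_of_nonneg hr hV.seqCotSum_pos.le
  linarith

end IsConvexSeq

/-! ### Areas -/

/-- The cross product with a fixed vector, as a linear functional. -/
def crossLin (u : Plane) : Plane →ₗ[ℝ] ℝ where
  toFun v := planeCross u v
  map_add' v w := by simp [planeCross]; ring
  map_smul' r v := by simp [planeCross]; ring

theorem volume_planeCross_eq {u : Plane} (hu : u ≠ 0) (k : ℝ) :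
    volume {v : Plane | planeCross u v = k} = 0 := by
  rcases eq_empty_or_nonempty {v : Plane | planeCross u v = k} with h | ⟨p, hp⟩
  · rw [h, measure_empty]
  have hset : {v : Plane | planeCross u v = k} =
      (AffineSubspace.mk' p (LinearMap.ker (crossLin u)) : Set Plane) := by
    ext v
    rw [SetLike.mem_coe, AffineSubspace.mem_mk', LinearMap.mem_ker, vsub_eq_sub, map_sub,
      sub_eq_zero]
    change planeCross u v = k ↔ planeCross u v = planeCross u p
    rw [show planeCross u p = k from hp]
  rw [hset]
  refine Measure.addHaar_affineSubspace _ _ fun htop => hu ?_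
  have hdir := congrArg AffineSubspace.direction htop
  rw [AffineSubspace.direction_mk', AffineSubspace.direction_top] at hdir
  have h0 : ∀ v, planeCross u v = 0 := fun v => by
    have : v ∈ LinearMap.ker (crossLin u) := hdir ▸ Submodule.mem_top
    exact this
  have h1 := h0 !₂[-u 1, u 0]
  simp [planeCross] at h1
  apply plane_ext
  · simp; nlinarith [sq_nonneg (u 0), sq_nonneg (u 1)]
  · simp; nlinarith [sq_nonneg (u 0), sq_nonneg (u 1)]

/-- The standard triangle with vertices `0`, `e₁` and `e₂`. -/
def stdTriangle : Set Plane := {v | 0 ≤ v 0 ∧ 0 ≤ v 1 ∧ v 0 + v 1 ≤ 1}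

theorem measurableSet_stdTriangle : MeasurableSet stdTriangle := by
  have h0 : Continuous fun v : Plane => v 0 := by fun_prop
  have h1 : Continuous fun v : Plane => v 1 := by fun_prop
  exact ((isClosed_le continuous_const h0).inter ((isClosed_le continuous_const h1).inter
    (isClosed_le (h0.add h1) continuous_const))).measurableSet

/-- The triangle and its reflection in the centre of the unit square cover the square and meet only
on a diagonal. -/
theorem volume_stdTriangle : volume stdTriangle = ENNReal.ofReal (1 / 2) := by
  set sq : Set Plane := {v | v 0 ∈ Icc (0 : ℝ) 1 ∧ v 1 ∈ Icc (0 : ℝ) 1} with hsq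
  have hvsq : volume sq = 1 := by
    have h := (PiLp.volume_preserving_ofLp (Fin 2)).measure_preimage
      (s := Set.pi univ fun _ => Icc (0 : ℝ) 1)
      (MeasurableSet.univ_pi fun _ => measurableSet_Icc).nullMeasurableSet
    rw [volume_pi_pi] at h
    simp only [Real.volume_Icc, sub_zero, ENNReal.ofReal_one, Finset.prod_const_one] at h
    rw [← h]
    congr 1
    ext v
    simp only [hsq, mem_ofPred_eq, mem_preimage, mem_univ_pi, Fin.forall_fin_two]
  set o : Plane := !₂[1, 1] with ho
  have ho0 : o 0 = 1 := rfl
  have ho1 : o 1 = 1 := rfl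
  set T' : Set Plane := (fun v => o - v) ⁻¹' stdTriangle with hT'
  have hvT' : volume T' = volume stdTriangle :=
    (Measure.measurePreserving_sub_left volume o).measure_preimage
      measurableSet_stdTriangle.nullMeasurableSet
  have hunion : sq = stdTriangle ∪ T' := by
    ext v
    simp only [hsq, hT', stdTriangle, mem_ofPred_eq, mem_union, mem_preimage, mem_Icc,
      PiLp.sub_apply, ho0, ho1]
    constructor
    · rintro ⟨⟨h1, h2⟩, h3, h4⟩
      rcases le_total (v 0 + v 1) 1 with h | h
      · exact Or.inl ⟨h1, h3, h⟩
      · exact Or.inr ⟨by linarith, by linarith, by linarith⟩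
    · rintro (⟨h1, h2, h3⟩ | ⟨h1, h2, h3⟩) <;> refine ⟨⟨?_, ?_⟩, ?_, ?_⟩ <;> linarith
  have hdisj : AEDisjoint volume stdTriangle T' := by
    refine measure_mono_null ?_ (volume_planeCross_eq (u := !₂[1, -1]) ?_ 1)
    · rintro v ⟨⟨h1, h2, h3⟩, h4⟩
      simp only [hT', stdTriangle, mem_ofPred_eq, mem_preimage, PiLp.sub_apply, ho0, ho1] at h4
      simp [planeCross]
      linarith [h4.2.2]
    · intro h
      have := congrArg (fun v : Plane => v 0) h
      simp at this
  have hT'm : MeasurableSet T' :=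
    (Measure.measurePreserving_sub_left volume o).measurable measurableSet_stdTriangle
  rw [hunion, measure_union₀ hT'm.nullMeasurableSet hdisj, hvT'] at hvsq
  have h2 : 2 * volume stdTriangle = 1 := by rw [two_mul]; exact hvsq
  rw [one_div, ENNReal.ofReal_inv_of_pos two_pos, ENNReal.ofReal_ofNat]
  exact ENNReal.eq_inv_of_mul_eq_one_left (by rw [mul_comm]; exact h2)

/-- The linear map with given columns. -/
def columnsLin (u w : Plane) : Plane →ₗ[ℝ] Plane where
  toFun v := v 0 • u + v 1 • w
  map_add' v v' := by simp only [PiLp.add_apply]; module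
  map_smul' r v := by simp only [PiLp.smul_apply, smul_eq_mul, RingHom.id_apply]; module

theorem det_columnsLin (u w : Plane) : LinearMap.det (columnsLin u w) = planeCross u w := by
  rw [← LinearMap.det_toMatrix (EuclideanSpace.basisFun (Fin 2) ℝ).toBasis, Matrix.det_fin_two]
  simp [LinearMap.toMatrix_apply, columnsLin, planeCross]
  ring

/-- The triangle with vertices `a`, `a + u` and `a + w`. -/
def triangleSet (a u w : Plane) : Set Plane :=
  (fun v => a + v) '' (columnsLin u w '' stdTriangle)

theorem mem_triangleSet {a u w x : Plane} : x ∈ triangleSet a u w ↔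
    ∃ s t : ℝ, 0 ≤ s ∧ 0 ≤ t ∧ s + t ≤ 1 ∧ x = a + (s • u + t • w) := by
  constructor
  · rintro ⟨_, ⟨v, ⟨h1, h2, h3⟩, rfl⟩, rfl⟩
    exact ⟨v 0, v 1, h1, h2, h3, rfl⟩
  · rintro ⟨s, t, h1, h2, h3, rfl⟩
    exact ⟨_, ⟨!₂[s, t], ⟨h1, h2, h3⟩, rfl⟩, rfl⟩

theorem volume_triangleSet {a u w : Plane} (h : 0 < planeCross u w) :
    volume (triangleSet a u w) = ENNReal.ofReal (planeCross u w / 2) := by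
  rw [triangleSet, image_add_left, measure_preimage_add, Measure.addHaar_image_linearMap,
    det_columnsLin, abs_of_pos h, volume_stdTriangle, ← ENNReal.ofReal_mul h.le]
  congr 1; ring

theorem nullMeasurableSet_triangleSet (a u w : Plane) :
    NullMeasurableSet (triangleSet a u w) volume := by
  have hc : Convex ℝ (triangleSet a u w) := by
    have h0 : Convex ℝ stdTriangle := by
      rintro x ⟨hx0, hx1, hx2⟩ y ⟨hy0, hy1, hy2⟩ s t hs ht hst
      simp only [stdTriangle, mem_ofPred_eq, PiLp.add_apply, PiLp.smul_apply, smul_eq_mul]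
      refine ⟨by positivity, by positivity, ?_⟩
      nlinarith
    exact (h0.linear_image _).translate a
  exact hc.nullMeasurableSet volume

/-! ### The fan triangulation from the vertex V 0 -/

namespace IsConvexSeq

variable {n : ℕ} {V : ℕ → Plane}

/-- Induction on k through the Plücker relation between the vectors from V 0 to V 1, V i, V k and V
(k + 1). -/
theorem fan_cross_pos (hV : IsConvexSeq n V) {i k : ℕ} (hi : 1 ≤ i) (hik : i < k) (hk : k < n) :
    0 < planeCross (V i - V 0) (V k - V 0) := by
  have base : ∀ i, 1 ≤ i → i + 1 < n → 0 < planeCross (V i - V 0) (V (i + 1) - V 0) := by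
    intro i h1 h2
    have := hV.left i 0 (fun h => not_modEq (n := n) (a := 0) (b := i) (by omega) (by omega) h.symm)
      (fun h => not_modEq (n := n) (a := 0) (b := i + 1) (by omega) (by omega) h.symm)
    simp only [planeCross, PiLp.sub_apply] at this ⊢
    linarith
  have he : ∀ k, 2 ≤ k → k < n → 0 < planeCross (V 1 - V 0) (V k - V 0) := fun k h1 h2 =>
    hV.left 0 k (not_modEq (by omega) (by omega)) (not_modEq (by omega) (by omega))
  induction k, hik using Nat.le_induction with
  | base => exact base i hi hk
  | succ k hk' ih =>
    have hik : i < k := hk'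
    have h1 := ih (by omega)
    have h2 := base k (by omega) hk
    have h3 := he k (by omega) (by omega)
    have h4 := he (k + 1) (by omega) hk
    have h5 := hV.left_nonneg 0 i
    rw [zero_add] at h5
    have key : planeCross (V 1 - V 0) (V k - V 0) * planeCross (V i - V 0) (V (k + 1) - V 0) =
        planeCross (V 1 - V 0) (V i - V 0) * planeCross (V k - V 0) (V (k + 1) - V 0) +
        planeCross (V 1 - V 0) (V (k + 1) - V 0) * planeCross (V i - V 0) (V k - V 0) := by
      simp only [planeCross]; ring
    have : 0 < planeCross (V 1 - V 0) (V k - V 0) * planeCross (V i - V 0) (V (k + 1) - V 0) := by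
      rw [key]; exact add_pos_of_nonneg_of_pos (mul_nonneg h5 h2.le) (mul_pos h4 h1)
    exact pos_of_mul_pos_right this h3.le

theorem left_of_mem_convexHull (hV : IsConvexSeq n V) {x : Plane}
    (hx : x ∈ convexHull ℝ (range V)) (i : ℕ) : 0 ≤ planeCross (V (i + 1) - V i) (x - V i) := by
  have hconv : Convex ℝ {x : Plane | 0 ≤ planeCross (V (i + 1) - V i) (x - V i)} := by
    have : {x : Plane | 0 ≤ planeCross (V (i + 1) - V i) (x - V i)} =
        {x : Plane | crossLin (V (i + 1) - V i) (V i) ≤ crossLin (V (i + 1) - V i) x} := by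
      ext x
      simp only [mem_ofPred_eq]
      rw [← sub_nonneg (b := crossLin (V (i + 1) - V i) (V i)), ← map_sub]
      rfl
    rw [this]
    exact convex_halfSpace_ge (crossLin _).isLinear _
  have hsub : range V ⊆ {x : Plane | 0 ≤ planeCross (V (i + 1) - V i) (x - V i)} := by
    rintro _ ⟨k, rfl⟩; exact hV.left_nonneg i k
  exact convexHull_min hsub hconv hx

theorem convexHull_eq_biUnion (hV : IsConvexSeq n V) : convexHull ℝ (range V) =
    ⋃ i ∈ Finset.Ico 1 (n - 1), triangleSet (V 0) (V i - V 0) (V (i + 1) - V 0) := by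
  have h3 := hV.three_le
  apply Subset.antisymm
  · intro x hx
    have h1 := hV.left_of_mem_convexHull hx 0
    have h2 := hV.left_of_mem_convexHull hx (n - 1)
    have hp := hV.periodic 0
    rw [show n - 1 + 1 = 0 + n by omega, hp] at h2
    have h2' : planeCross (V (n - 1) - V 0) (x - V 0) ≤ 0 := by
      simp only [planeCross, PiLp.sub_apply] at h2 ⊢; linarith
    -- Seen from V 0, the point is to the left of V 1 and to the right of V (n - 1), so the sign
    -- changes somewhere; that index gives the triangle containing it.
    obtain ⟨i, hi1, hi2, hi3, hi4⟩ : ∃ i, 1 ≤ i ∧ i + 1 ≤ n - 1 ∧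
        0 ≤ planeCross (V i - V 0) (x - V 0) ∧ planeCross (V (i + 1) - V 0) (x - V 0) ≤ 0 := by
      by_contra! hcon
      have : ∀ i, 1 ≤ i → i ≤ n - 1 → 0 ≤ planeCross (V i - V 0) (x - V 0) := by
        intro i hi
        induction i, hi using Nat.le_induction with
        | base => intro _; simpa using h1
        | succ k hk ih => intro hk'; exact (hcon k hk hk' (ih (by omega))).le
      have := hcon (n - 2) (by omega) (by omega) (this (n - 2) (by omega) (by omega))
      rw [show n - 2 + 1 = n - 1 by omega] at this
      linarith
    have hD := hV.fan_cross_pos hi1 (Nat.lt_succ_self i) (by omega)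
    have hl := hV.left_of_mem_convexHull hx i
    rw [Nat.succ_eq_add_one] at hD
    refine mem_biUnion (Finset.mem_coe.2 (Finset.mem_Ico.2 ⟨hi1, by omega⟩)) (mem_triangleSet.2 ?_)
    set D := planeCross (V i - V 0) (V (i + 1) - V 0) with hDdef
    refine ⟨-planeCross (V (i + 1) - V 0) (x - V 0) / D, planeCross (V i - V 0) (x - V 0) / D,
      div_nonneg (by linarith) hD.le, div_nonneg hi3 hD.le, ?_, ?_⟩
    · rw [← add_div, div_le_one hD, hDdef]
      simp only [planeCross, PiLp.sub_apply] at hl ⊢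
      linarith
    · apply plane_ext <;>
      · simp only [PiLp.add_apply, PiLp.smul_apply, smul_eq_mul, PiLp.sub_apply]
        field_simp
        simp only [hDdef, planeCross, PiLp.sub_apply]
        ring
  · refine iUnion₂_subset fun i _ x hx => ?_
    obtain ⟨s, t, hs, ht, hst, rfl⟩ := mem_triangleSet.1 hx
    have hm : ∀ k, V k ∈ convexHull ℝ (range V) := fun k => subset_convexHull ℝ _ ⟨k, rfl⟩
    have := (convex_convexHull ℝ (range V)).sum_mem (t := Finset.univ) (w := ![1 - s - t, s, t])
      (z := ![V 0, V i, V (i + 1)])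
      (by intro l _; fin_cases l <;> simp <;> linarith)
      (by simp [Fin.sum_univ_three]; ring)
      (by intro l _; fin_cases l <;> simp [hm])
    rw [Fin.sum_univ_three] at this
    convert this using 1
    simp only [Matrix.cons_val_zero, Matrix.cons_val_one, Matrix.cons_val]
    module

/-- The line through V 0 and V k separates the two triangles, so they can meet only on it. -/
theorem aedisjoint_fan (hV : IsConvexSeq n V) {i k : ℕ} (hi : 1 ≤ i) (hik : i < k)
    (hk : k < n - 1) : AEDisjoint volume (triangleSet (V 0) (V i - V 0) (V (i + 1) - V 0))
      (triangleSet (V 0) (V k - V 0) (V (k + 1) - V 0)) := by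
  have h1 := hV.fan_cross_pos hi hik (by omega)
  have h2 : 0 ≤ planeCross (V (i + 1) - V 0) (V k - V 0) := by
    rcases (Nat.succ_le_of_lt hik).eq_or_lt with h | h
    · rw [← h]; simp [planeCross, mul_comm]
    · exact (hV.fan_cross_pos (by omega) h (by omega)).le
  have h3 := hV.fan_cross_pos (show 1 ≤ k by omega) (Nat.lt_succ_self k) (by omega)
  have hne : V k - V 0 ≠ 0 := by
    intro h; rw [h] at h1; simp [planeCross] at h1
  refine measure_mono_null ?_ (volume_planeCross_eq hne (planeCross (V k - V 0) (V 0)))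
  rintro x ⟨ha, hb⟩
  obtain ⟨s, t, hs, ht, -, hx⟩ := mem_triangleSet.1 ha
  obtain ⟨s', t', hs', ht', -, hx'⟩ := mem_triangleSet.1 hb
  have e1 : planeCross (V k - V 0) x - planeCross (V k - V 0) (V 0) =
      -(s * planeCross (V i - V 0) (V k - V 0) + t * planeCross (V (i + 1) - V 0) (V k - V 0)) := by
    rw [hx]; simp only [planeCross, PiLp.add_apply, PiLp.smul_apply, smul_eq_mul]; ring
  have e2 : planeCross (V k - V 0) x - planeCross (V k - V 0) (V 0) =
      t' * planeCross (V k - V 0) (V (k + 1) - V 0) := by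
    rw [hx']; simp only [planeCross, PiLp.add_apply, PiLp.smul_apply, smul_eq_mul]; ring
  have f1 : 0 ≤ t' * planeCross (V k - V 0) (V (k + 1) - V 0) := mul_nonneg ht' h3.le
  have f2 := mul_nonneg hs h1.le
  have f3 := mul_nonneg ht h2
  change planeCross (V k - V 0) x = planeCross (V k - V 0) (V 0)
  linarith

/-- The shoelace formula. -/
theorem volume_convexHull (hV : IsConvexSeq n V) (c : Plane) :
    volume.real (convexHull ℝ (range V)) = seqDoubleArea n V c / 2 := by
  have h3 := hV.three_le
  have hpos : ∀ i ∈ Finset.Ico 1 (n - 1), 0 < planeCross (V i - V 0) (V (i + 1) - V 0) := by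
    intro i hi
    rw [Finset.mem_Ico] at hi
    exact hV.fan_cross_pos hi.1 (Nat.lt_succ_self i) (by omega)
  have hvol : volume (convexHull ℝ (range V)) =
      ENNReal.ofReal (∑ i ∈ Finset.Ico 1 (n - 1), planeCross (V i - V 0) (V (i + 1) - V 0) / 2) := by
    rw [hV.convexHull_eq_biUnion, measure_biUnion_finset₀]
    · rw [ENNReal.ofReal_sum_of_nonneg fun i hi => (half_pos (hpos i hi)).le]
      exact Finset.sum_congr rfl fun i hi => volume_triangleSet (hpos i hi)
    · intro i hi k hk hik
      rw [Finset.mem_coe, Finset.mem_Ico] at hi hk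
      rcases lt_or_gt_of_ne hik with h | h
      · exact hV.aedisjoint_fan hi.1 h hk.2
      · exact (hV.aedisjoint_fan hk.1 h hi.2).symm
    · exact fun i _ => nullMeasurableSet_triangleSet _ _ _
  rw [Measure.real, hvol,
    ENNReal.toReal_ofReal (Finset.sum_nonneg fun i hi => (half_pos (hpos i hi)).le),
    ← Finset.sum_div, hV.seqDoubleArea_eq c (V 0), seqDoubleArea]
  congr 1
  obtain ⟨m, rfl⟩ : ∃ m, n = m + 1 := ⟨n - 1, by omega⟩
  have hp := hV.periodic 0
  rw [zero_add] at hp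
  have h0 : ∀ v : Plane, planeCross (V 0 - V 0) v = 0 := fun v => by simp [planeCross]
  have hlast : planeCross (V m - V 0) (V 0 - V 0) = 0 := by simp [planeCross]
  rw [Finset.sum_range_succ, hp, Nat.add_sub_cancel, hlast, add_zero,
    Finset.sum_range_eq_add_Ico _ (by omega), h0, zero_add]

end IsConvexSeq

/-! ### Circumscribed sequences: tangency points, congruence, existence -/

theorem inner_dirVec_mul_sin (u : Plane) (t x : ℝ) : inner ℝ u (dirVec t) * sin x =
    planeCross u (dirVec (t + x)) - planeCross u (dirVec t) * cos x := by
  simp only [plane_inner, planeCross, dirVec_zero, dirVec_one, cos_add, sin_add]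
  ring

theorem inner_dirVec_add_mul_sin (u : Plane) (t x : ℝ) : inner ℝ u (dirVec (t + x)) * sin x =
    planeCross u (dirVec (t + x)) * cos x - planeCross u (dirVec t) := by
  simp only [plane_inner, planeCross, dirVec_zero, dirVec_one, cos_add, sin_add]
  linear_combination (u 1 * cos t - u 0 * sin t) * sin_sq_add_cos_sq x

/-- The rotation by a given angle. -/
def rotVec (δ : ℝ) (v : Plane) : Plane :=
  !₂[cos δ * v 0 - sin δ * v 1, sin δ * v 0 + cos δ * v 1]

@[simp] theorem rotVec_zero (δ : ℝ) (v : Plane) : rotVec δ v 0 = cos δ * v 0 - sin δ * v 1 := rfl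
@[simp] theorem rotVec_one (δ : ℝ) (v : Plane) : rotVec δ v 1 = sin δ * v 0 + cos δ * v 1 := rfl

theorem rotVec_neg_cancel (δ : ℝ) (v : Plane) : rotVec δ (rotVec (-δ) v) = v := by
  have := sin_sq_add_cos_sq δ
  apply plane_ext <;> simp
  · linear_combination v 0 * this
  · linear_combination v 1 * this

theorem norm_rotVec_sub (δ : ℝ) (u v : Plane) : ‖rotVec δ u - rotVec δ v‖ = ‖u - v‖ := by
  rw [← sq_eq_sq₀ (norm_nonneg _) (norm_nonneg _), plane_norm_sq, plane_norm_sq]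
  simp
  linear_combination ((u 0 - v 0) ^ 2 + (u 1 - v 1) ^ 2) * sin_sq_add_cos_sq δ

theorem rotVec_eq {u u' : Plane} {t t' : ℝ}
    (hc : planeCross u (dirVec t) = planeCross u' (dirVec t'))
    (hi : inner ℝ u (dirVec t) = inner ℝ u' (dirVec t')) : rotVec (t' - t) u = u' := by
  have h1 := sin_sq_add_cos_sq t'
  simp only [plane_inner, planeCross, dirVec_zero, dirVec_one] at hc hi
  apply plane_ext
  · rw [rotVec_zero, cos_sub, sin_sub]
    linear_combination cos t' * hi + sin t' * hc + u' 0 * h1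
  · rw [rotVec_one, cos_sub, sin_sub]
    linear_combination sin t' * hi - cos t' * hc + u' 1 * h1

/-- The rigid motion that turns by `δ` and takes `c` to `c'`. -/
def rigidMotion (δ : ℝ) (c c' : Plane) : Plane ≃ᵢ Plane :=
  IsometryEquiv.mk' (fun v => c' + rotVec δ (v - c)) (fun v => c + rotVec (-δ) (v - c'))
    (fun v => by simp [rotVec_neg_cancel])
    (Isometry.of_dist_eq fun u v => by
      rw [dist_eq_norm, dist_eq_norm, add_sub_add_left_eq_sub, norm_rotVec_sub,
        sub_sub_sub_cancel_right])

/-- The two tangent segments from a vertex to the circle both have length r cot(θ/2), with θ the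
interior angle. -/
theorem IsInscribed.inner_dirVec {n : ℕ} {V : ℕ → Plane} (hV : IsConvexSeq n V) {c : Plane} {r t : ℝ}
    (h : IsInscribed V c r) (ht : ∀ i,
      V (i + 1) - V i = ‖V (i + 1) - V i‖ • dirVec (t + turning (extAngle V) i)) (i : ℕ) :
    inner ℝ (V (i + 1) - c) (dirVec (t + turning (extAngle V) i)) =
        r * halfCot (π - extAngle V i) ∧
      inner ℝ (V (i + 1) - c) (dirVec (t + turning (extAngle V) (i + 1))) =
        -(r * halfCot (π - extAngle V i)) := by
  have hx := hV.extAngle_mem i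
  have hs := (sin_pos_of_mem_Ioo hx).ne'
  have h1 := (hV.isInscribed_iff ht c r i).1 (h i)
  have h2 := (hV.isInscribed_iff ht c r (i + 1)).1 (h (i + 1))
  have h1' : planeCross (V (i + 1) - c) (dirVec (t + turning (extAngle V) i)) = r := by
    rw [← h1]
    have e0 := congrArg (fun v : Plane => v 0) (ht i)
    have e1 := congrArg (fun v : Plane => v 1) (ht i)
    simp only [PiLp.smul_apply, smul_eq_mul, PiLp.sub_apply, dirVec_zero, dirVec_one] at e0 e1
    simp only [planeCross, PiLp.sub_apply, dirVec_zero, dirVec_one]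
    linear_combination sin (t + turning (extAngle V) i) * e0 -
      cos (t + turning (extAngle V) i) * e1
  rw [turning_succ, ← add_assoc] at h2 ⊢
  have a1 := inner_dirVec_mul_sin (V (i + 1) - c) (t + turning (extAngle V) i) (extAngle V i)
  have a2 := inner_dirVec_add_mul_sin (V (i + 1) - c) (t + turning (extAngle V) i) (extAngle V i)
  rw [h1', h2] at a1 a2
  rw [halfCot_pi_sub hx]
  constructor <;> field_simp <;> linarith

/-- Two sequences with the same exterior angles, circumscribed around circles of the same radius, are
congruent. -/
theorem IsInscribed.exists_isometry {n : ℕ} {V W : ℕ → Plane} (hV : IsConvexSeq n V)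
    (hW : IsConvexSeq n W) (hVW : ∀ i, extAngle V i = extAngle W i) {c c' : Plane} {r : ℝ}
    (h : IsInscribed V c r) (h' : IsInscribed W c' r) :
    ∃ e : Plane ≃ᵢ Plane, ∀ i, e (V i) = W i := by
  obtain ⟨t, ht⟩ := hV.exists_polar
  obtain ⟨t', ht'⟩ := hW.exists_polar
  have hfun : extAngle V = extAngle W := funext hVW
  have hsucc : ∀ i, rigidMotion (t' - t) c c' (V (i + 1)) = W (i + 1) := by
    intro i
    change c' + rotVec (t' - t) (V (i + 1) - c) = W (i + 1)
    rw [← eq_sub_iff_add_eq',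
      show t' - t = (t' + turning (extAngle W) (i + 1)) - (t + turning (extAngle V) (i + 1)) by
        rw [hfun]; ring]
    apply rotVec_eq
    · rw [(hV.isInscribed_iff ht c r (i + 1)).1 (h (i + 1)),
        (hW.isInscribed_iff ht' c' r (i + 1)).1 (h' (i + 1))]
    · rw [(IsInscribed.inner_dirVec hV h ht i).2, (IsInscribed.inner_dirVec hW h' ht' i).2, hVW]
  refine ⟨rigidMotion (t' - t) c c', fun i => ?_⟩
  obtain ⟨m, hm⟩ : ∃ m, i + n = m + 1 := ⟨i + n - 1, by have := hV.three_le; omega⟩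
  rw [← hV.periodic i, ← hW.periodic i, hm]
  exact hsucc m

/-- The foot of the perpendicular from c lies within the side because the tangent lengths at both
ends are positive. -/
theorem IsInscribed.exists_isTangentAt {n : ℕ} {V : ℕ → Plane} (hV : IsConvexSeq n V)
    {c : Plane} {r : ℝ} (hr : 0 < r) (h : IsInscribed V c r) (i : ℕ) :
    ∃ p ∈ segment ℝ (V i) (V (i + 1)),
      (⟨c, r⟩ : EuclideanGeometry.Sphere Plane).IsTangentAt p
        (affineSpan ℝ {V i, V (i + 1)}) := by
  obtain ⟨t, ht⟩ := hV.exists_polar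
  set ψ := t + turning (extAngle V) i with hψ
  set l := ‖V (i + 1) - V i‖ with hl
  have hl0 : 0 < l := hV.norm_edge_pos i
  set b := inner ℝ (V i - c) (dirVec ψ) with hb
  have hbneg : b ≤ 0 := by
    -- The tangent length at V i is known only as at the end of the preceding edge; passing to i + n
    -- provides a predecessor when i = 0.
    obtain ⟨m, hm⟩ : ∃ m, i + n = m + 1 := ⟨i + n - 1, by have := hV.three_le; omega⟩
    have h1 := (IsInscribed.inner_dirVec hV h ht m).2
    have h2 : dirVec (t + turning (extAngle V) (m + 1)) = dirVec ψ := by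
      have : turning (extAngle V) (m + 1) = turning (extAngle V) i + 2 * π := by
        rw [← hm, add_comm i n, turning_add, hV.turning_eq_two_pi,
          show (fun i => extAngle V (n + i)) = extAngle V from
            funext fun i => by rw [add_comm]; exact hV.extAngle_periodic i]
        ring
      rw [this, ← add_assoc, dirVec, cos_add_two_pi, sin_add_two_pi, ← hψ, dirVec]
    rw [← hm, hV.periodic, hm, h2] at h1
    rw [hb, h1]
    have := mul_pos hr (halfCot_pi_sub_pos (hV.extAngle_mem m))
    linarith
  have hcross : planeCross (V i - c) (dirVec ψ) = r := (hV.isInscribed_iff ht c r i).1 (h i)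
  have e0 : V (i + 1) 0 - V i 0 = l * cos ψ := by
    have := congrArg (fun v : Plane => v 0) (ht i); simpa using this
  have e1 : V (i + 1) 1 - V i 1 = l * sin ψ := by
    have := congrArg (fun v : Plane => v 1) (ht i); simpa using this
  have hsc := sin_sq_add_cos_sq ψ
  have hapos : 0 ≤ b + l := by
    have h1 := (IsInscribed.inner_dirVec hV h ht i).1
    have h2 : inner ℝ (V (i + 1) - c) (dirVec ψ) = b + l := by
      simp only [hb, plane_inner, PiLp.sub_apply, dirVec_zero, dirVec_one]
      linear_combination cos ψ * e0 + sin ψ * e1 + l * hsc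
    rw [← h2, h1]
    exact (mul_pos hr (halfCot_pi_sub_pos (hV.extAngle_mem i))).le
  have hb' : b = (V i 0 - c 0) * cos ψ + (V i 1 - c 1) * sin ψ := by rw [hb, plane_inner]; rfl
  simp only [planeCross, PiLp.sub_apply, dirVec_zero, dirVec_one] at hcross
  set p : Plane := !₂[c 0 + r * sin ψ, c 1 - r * cos ψ] with hp
  have p0 : p 0 = c 0 + r * sin ψ := rfl
  have p1 : p 1 = c 1 - r * cos ψ := rfl
  have q0 : V i 0 - c 0 = b * cos ψ + r * sin ψ := by
    rw [hb']; linear_combination sin ψ * hcross - (V i 0 - c 0) * hsc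
  have q1 : V i 1 - c 1 = b * sin ψ - r * cos ψ := by
    rw [hb']; linear_combination (-cos ψ) * hcross - (V i 1 - c 1) * hsc
  have hseg : p ∈ segment ℝ (V i) (V (i + 1)) := by
    rw [segment_eq_image]
    refine ⟨-b / l, ⟨div_nonneg (by linarith) hl0.le, by rw [div_le_one hl0]; linarith⟩, ?_⟩
    have hbl : -b / l * l = -b := div_mul_cancel₀ _ hl0.ne'
    apply plane_ext <;> simp only [PiLp.add_apply, PiLp.smul_apply, smul_eq_mul]
    · rw [p0]; linear_combination (-b / l) * e0 + q0 + cos ψ * hbl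
    · rw [p1]; linear_combination (-b / l) * e1 + q1 + sin ψ * hbl
  refine ⟨p, hseg, ?_, ?_, ?_⟩
  · rw [EuclideanGeometry.mem_sphere, dist_eq_norm,
      ← sq_eq_sq₀ (norm_nonneg _) hr.le, plane_norm_sq]
    simp only [PiLp.sub_apply, p0, p1]
    linear_combination r ^ 2 * hsc
  · rw [segment_eq_image_lineMap] at hseg
    obtain ⟨s, -, hs⟩ := hseg
    rw [← hs]
    exact AffineMap.lineMap_mem_affineSpan_pair _ _ _
  · rw [affineSpan_le]
    rintro x (rfl | rfl)
    · rw [SetLike.mem_coe, EuclideanGeometry.Sphere.mem_orthRadius_iff_inner_left]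
      simp only [vsub_eq_sub, plane_inner, PiLp.sub_apply, p0, p1]
      linear_combination r * sin ψ * q0 - r * cos ψ * q1
    · rw [SetLike.mem_coe, EuclideanGeometry.Sphere.mem_orthRadius_iff_inner_left]
      simp only [vsub_eq_sub, plane_inner, PiLp.sub_apply, p0, p1]
      linear_combination r * sin ψ * (q0 + e0) - r * cos ψ * (q1 + e1)

theorem eq_zero_of_planeCross_of_inner {u v : Plane} (hu : u ≠ 0) (hc : planeCross u v = 0)
    (hi : inner ℝ u v = 0) : v = 0 := by
  have h := planeCross_sq_add_inner_sq u v
  rw [hc, hi] at h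
  have : ‖u‖ * ‖v‖ = 0 := by
    rw [← sq_eq_zero_iff, ← h]; norm_num
  exact norm_eq_zero.1 ((mul_eq_zero.1 this).resolve_left (norm_ne_zero_iff.2 hu))

/-- A circle that touches all sides within the sides is inscribed. -/
theorem isInscribed_of_isTangentAt {n : ℕ} {V : ℕ → Plane} (hV : IsConvexSeq n V)
    (s : EuclideanGeometry.Sphere Plane) (hr : 0 < s.radius) {p : ℕ → Plane}
    (hseg : ∀ i, p i ∈ segment ℝ (V i) (V (i + 1)))
    (htan : ∀ i, s.IsTangentAt (p i) (affineSpan ℝ {V i, V (i + 1)})) :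
    IsInscribed V s.center s.radius := by
  set c := s.center
  set r := s.radius
  have hnorm : ∀ i, ‖p i - c‖ = r := fun i => by
    rw [← dist_eq_norm]; exact (htan i).mem_sphere
  have hex : ∀ i, ∃ u : ℝ, 0 ≤ u ∧ u ≤ 1 ∧ V i + u • (V (i + 1) - V i) = p i := fun i => by
    have := hseg i
    rw [segment_eq_image'] at this
    obtain ⟨u, hu, h⟩ := this
    exact ⟨u, hu.1, hu.2, h⟩
  choose u hu0 hu1 hu using hex
  have hin : ∀ i, inner ℝ (V (i + 1) - V i) (p i - c) = 0 := by
    intro i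
    have h1 := (htan i).inner_left_eq_zero_of_mem (left_mem_affineSpan_pair ℝ (V i) (V (i + 1)))
    have h2 := (htan i).inner_left_eq_zero_of_mem (right_mem_affineSpan_pair ℝ (V i) (V (i + 1)))
    simp only [vsub_eq_sub] at h1 h2
    rw [show V (i + 1) - V i = (V (i + 1) - p i) - (V i - p i) by abel, inner_sub_left, h2, h1,
      sub_zero]
  have hshift : ∀ i, planeCross (V i - c) (V (i + 1) - V i) =
      -planeCross (V (i + 1) - V i) (p i - c) := by
    intro i
    rw [← hu i]
    simp only [planeCross, PiLp.sub_apply, PiLp.add_apply, PiLp.smul_apply, smul_eq_mul]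
    ring
  have hsq : ∀ i, planeCross (V (i + 1) - V i) (p i - c) ^ 2 = (r * ‖V (i + 1) - V i‖) ^ 2 := by
    intro i
    have := planeCross_sq_add_inner_sq (V (i + 1) - V i) (p i - c)
    rw [hin i, hnorm i] at this
    linarith
  intro i
  rw [hshift]
  rcases sq_eq_sq_iff_eq_or_eq_neg.1 (hsq i) with h | h
  swap
  · rw [h, neg_neg]
  -- The remaining sign puts the centre on the outer side of edge i. The disc then meets the
  -- polygon's half-plane only at `p i`, so all tangency points coincide. A point common to
  -- consecutive sides is their shared vertex, so two neighbouring vertices would coincide.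
  exfalso
  have hsame : ∀ k, p k = p i := by
    intro k
    have hle : planeCross (V (i + 1) - V i) (p k - c) ≤ r * ‖V (i + 1) - V i‖ := by
      have h1 := planeCross_sq_add_inner_sq (V (i + 1) - V i) (p k - c)
      rw [hnorm k] at h1
      apply le_of_sq_le_sq _ (by positivity)
      nlinarith [sq_nonneg (inner ℝ (V (i + 1) - V i) (p k - c))]
    have hge : 0 ≤ planeCross (V (i + 1) - V i) (p k - p i) := by
      have h1 := hV.left_nonneg i k
      have h2 := hV.left_nonneg i (k + 1)
      have h3 := mul_nonneg (sub_nonneg.2 (hu1 k)) h1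
      have h4 := mul_nonneg (hu0 k) h2
      rw [← hu k, ← hu i]
      simp only [planeCross, PiLp.sub_apply, PiLp.add_apply, PiLp.smul_apply, smul_eq_mul] at *
      linarith
    have hadd : planeCross (V (i + 1) - V i) (p k - c) =
        planeCross (V (i + 1) - V i) (p k - p i) + planeCross (V (i + 1) - V i) (p i - c) := by
      simp only [planeCross, PiLp.sub_apply]; ring
    have heq : planeCross (V (i + 1) - V i) (p k - c) = r * ‖V (i + 1) - V i‖ := by linarith
    have hzero : planeCross (V (i + 1) - V i) (p k - p i) = 0 := by linarith
    have hinz : inner ℝ (V (i + 1) - V i) (p k - c) = 0 := by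
      have h1 := planeCross_sq_add_inner_sq (V (i + 1) - V i) (p k - c)
      rw [hnorm k, heq] at h1
      rw [← sq_eq_zero_iff]; linarith
    refine sub_eq_zero.1 (eq_zero_of_planeCross_of_inner (hV.edge_ne_zero i) hzero ?_)
    rw [show p k - p i = (p k - c) - (p i - c) by abel, inner_sub_right, hinz, hin i, sub_zero]
  have hvert : ∀ k, p (k + 1) = p k → p (k + 1) = V (k + 1) := by
    intro k hk
    have h1 : u (k + 1) * planeCross (V (k + 1) - V k) (V (k + 1 + 1) - V (k + 1)) =
        planeCross (V (k + 1) - V k) (p (k + 1) - p k) := by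
      rw [← hu k, ← hu (k + 1)]
      simp only [planeCross, PiLp.sub_apply, PiLp.add_apply, PiLp.smul_apply, smul_eq_mul]
      ring
    have h2 : u (k + 1) = 0 := by
      rw [hk, sub_self] at h1
      refine (mul_eq_zero.1 (h1.trans ?_)).resolve_right (hV.cross_edge_pos k).ne'
      simp [planeCross]
    rw [← hu (k + 1), h2, zero_smul, add_zero]
  have h1 := hvert i ((hsame (i + 1)).trans (hsame i).symm)
  have h2 := hvert (i + 1) ((hsame (i + 1 + 1)).trans (hsame (i + 1)).symm)
  apply hV.edge_ne_zero (i + 1)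
  rw [← h1, ← h2, hsame, hsame (i + 1), sub_self]

theorem angle_smul_dirVec {a b : ℝ} (ha : 0 < a) (hb : 0 < b) (t : ℝ) {x : ℝ} (hx : x ∈ Ioo 0 π) :
    InnerProductGeometry.angle (a • dirVec t) (b • dirVec (t + x)) = x := by
  rw [InnerProductGeometry.angle_smul_left_of_pos _ _ ha,
    InnerProductGeometry.angle_smul_right_of_pos _ _ hb, InnerProductGeometry.angle, norm_dirVec,
    norm_dirVec, plane_inner]
  simp only [dirVec_zero, dirVec_one, mul_one, div_one]
  rw [← cos_sub, sub_add_cancel_left, cos_neg, arccos_cos hx.1.le hx.2.le]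

/-- The vertices of the circumscribed polygon of the circle with radius `r` around the origin, with
given exterior angles. -/
def circumscribedSeq (r : ℝ) (y : ℕ → ℝ) (i : ℕ) : Plane :=
  !₂[r * (sin (turning y i) + halfCot (π - y i) * cos (turning y i)),
    r * (-cos (turning y i) + halfCot (π - y i) * sin (turning y i))]

/-! ### Convexity and angles of the circumscribed polygon -/

section circumscribedSeq

variable {n : ℕ} {r : ℝ} {y : ℕ → ℝ}

/-- The definition reaches the vertex forwards from the tangency point of the incoming side; this
form reaches it backwards from that of the outgoing side. -/
theorem circumscribedSeq_eq (hy : ∀ i, y i ∈ Ioo 0 π) (i : ℕ) : circumscribedSeq r y i =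
    !₂[r * (sin (turning y (i + 1)) - halfCot (π - y i) * cos (turning y (i + 1))),
      r * (-cos (turning y (i + 1)) - halfCot (π - y i) * sin (turning y (i + 1)))] := by
  have hs := (sin_pos_of_mem_Ioo (hy i)).ne'
  have hsc := sin_sq_add_cos_sq (y i)
  rw [circumscribedSeq, turning_succ, sin_add, cos_add, halfCot_pi_sub (hy i)]
  congr 1
  ext k; fin_cases k
  · simp
    left
    field_simp
    linear_combination (-cos (turning y i)) * hsc
  · simp
    left
    field_simp
    linear_combination (-sin (turning y i)) * hsc

theorem circumscribedSeq_sub (hy : ∀ i, y i ∈ Ioo 0 π) (i : ℕ) :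
    circumscribedSeq r y (i + 1) - circumscribedSeq r y i =
      (r * (halfCot (π - y i) + halfCot (π - y (i + 1)))) • dirVec (turning y (i + 1)) := by
  rw [circumscribedSeq_eq hy i, circumscribedSeq]
  apply plane_ext
  · simp; ring
  · simp; ring

theorem isInscribed_circumscribedSeq (hr : 0 < r) (hy : ∀ i, y i ∈ Ioo 0 π) :
    IsInscribed (circumscribedSeq r y) 0 r := by
  intro i
  have hpos : 0 < r * (halfCot (π - y i) + halfCot (π - y (i + 1))) :=
    mul_pos hr (add_pos (halfCot_pi_sub_pos (hy _)) (halfCot_pi_sub_pos (hy _)))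
  rw [circumscribedSeq_sub hy, norm_smul, norm_dirVec, mul_one, Real.norm_of_nonneg hpos.le,
    sub_zero, circumscribedSeq_eq hy]
  have hsc := sin_sq_add_cos_sq (turning y (i + 1))
  simp [planeCross]
  linear_combination r ^ 2 * (halfCot (π - y i) + halfCot (π - y (i + 1))) * hsc

theorem isConvexSeq_circumscribedSeq (hn : 3 ≤ n) (hr : 0 < r) (hy : ∀ i, y i ∈ Ioo 0 π)
    (hper : ∀ i, y (i + n) = y i) (hsum : turning y n = 2 * π) :
    IsConvexSeq n (circumscribedSeq r y) := by
  have hturn : ∀ i, turning y (i + n) = turning y i + 2 * π := by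
    intro i
    rw [add_comm i n, turning_add, hsum,
      show (fun i => y (n + i)) = y from funext fun i => by rw [add_comm]; exact hper i]
    ring
  have hU : ∀ i, circumscribedSeq r y (i + n) = circumscribedSeq r y i := by
    intro i
    simp only [circumscribedSeq, hturn, hper, cos_add_two_pi, sin_add_two_pi]
  have hU' : Function.Periodic (circumscribedSeq r y) n := hU
  refine ⟨hn, hU, fun i k h1 h2 => ?_⟩
  -- m counts the steps from vertex i + 1 forward to a representative of k; the excluded residues
  -- bound it by 1 and n - 2.
  obtain ⟨m, hm1, hm2, hmk⟩ : ∃ m, 1 ≤ m ∧ m + 2 ≤ n ∧ i + 1 + m ≡ k [MOD n] := by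
    have hlt := Nat.mod_lt (k + (n - (i + 1) % n)) (show 0 < n by omega)
    have hi := Nat.mod_lt (i + 1) (show 0 < n by omega)
    have hmod : i + 1 + (k + (n - (i + 1) % n)) % n ≡ k [MOD n] := by
      have e1 : i + 1 + (k + (n - (i + 1) % n)) % n ≡ (i + 1) % n + (k + (n - (i + 1) % n)) [MOD n] :=
        (Nat.mod_modEq _ _).symm.add (Nat.mod_modEq _ _)
      have e2 : (i + 1) % n + (k + (n - (i + 1) % n)) = k + n := by omega
      rw [e2] at e1
      exact e1.trans (by simp [Nat.ModEq])
    refine ⟨_, ?_, ?_, hmod⟩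
    · by_contra hcon
      rw [show (k + (n - (i + 1) % n)) % n = 0 by omega, add_zero] at hmod
      exact h2 hmod.symm
    · by_contra hcon
      rw [show i + 1 + (k + (n - (i + 1) % n)) % n = i + n by omega] at hmod
      exact h1 (hmod.symm.trans (by simp [Nat.ModEq]))
  have hk : circumscribedSeq r y k = circumscribedSeq r y (i + 1 + m) := by
    rw [← hU'.map_mod_nat k, ← hU'.map_mod_nat (i + 1 + m), hmk]
  rw [hk]
  set z := i + 1 + m with hz
  have hpos : 0 < r * (halfCot (π - y i) + halfCot (π - y (i + 1))) :=
    mul_pos hr (add_pos (halfCot_pi_sub_pos (hy _)) (halfCot_pi_sub_pos (hy _)))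
  have hins := isInscribed_circumscribedSeq hr hy i
  rw [circumscribedSeq_sub hy, norm_smul, norm_dirVec, mul_one, Real.norm_of_nonneg hpos.le,
    sub_zero] at hins
  rw [circumscribedSeq_sub hy]
  set A := r * (halfCot (π - y i) + halfCot (π - y (i + 1))) with hA
  set φ := turning y z - turning y (i + 1) with hφ
  have hmono := turning_strictMono hy
  have hφ0 : 0 < φ := sub_pos.2 (hmono (by omega))
  have hφ2 : φ + y z < 2 * π := by
    have h3 := hmono (show z + 1 < i + 1 + n by omega)
    rw [turning_succ, hturn] at h3
    linarith
  have hyz := hy z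
  have hcross : planeCross (A • dirVec (turning y (i + 1)))
      (circumscribedSeq r y z - circumscribedSeq r y i) =
      A * r * (1 - (cos φ - halfCot (π - y z) * sin φ)) := by
    have e1 : planeCross (A • dirVec (turning y (i + 1)))
      (circumscribedSeq r y z - circumscribedSeq r y i) =
      planeCross (circumscribedSeq r y i) (A • dirVec (turning y (i + 1))) -
      planeCross (circumscribedSeq r y z) (A • dirVec (turning y (i + 1))) := by
      simp only [planeCross, PiLp.sub_apply]; ring
    rw [e1, hins, hφ, cos_sub, sin_sub, circumscribedSeq]
    simp [planeCross]
    ring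
  have hs : 0 < sin (y z) := sin_pos_of_mem_Ioo hyz
  -- φ is the turn from edge i to the edge entering vertex z. Positivity follows from the
  -- factorization into sines, as φ > 0 and φ + y z < 2π.
  have key : 0 < sin (y z) * (1 - (cos φ - halfCot (π - y z) * sin φ)) := by
    have e : sin (y z) * (1 - (cos φ - halfCot (π - y z) * sin φ)) =
        4 * sin (φ / 2) * sin (y z / 2) * sin (φ / 2 + y z / 2) := by
      have s1 : sin (y z) = 2 * sin (y z / 2) * cos (y z / 2) := by rw [← sin_two_mul]; ring_nf
      have s2 : sin φ = 2 * sin (φ / 2) * cos (φ / 2) := by rw [← sin_two_mul]; ring_nf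
      have c1 : cos (y z) = 1 - 2 * sin (y z / 2) ^ 2 := by
        rw [← cos_two_mul_eq_one_sub]; ring_nf
      have c2 : cos φ = 1 - 2 * sin (φ / 2) ^ 2 := by rw [← cos_two_mul_eq_one_sub]; ring_nf
      have e' : sin (y z) * (1 - (cos φ - halfCot (π - y z) * sin φ)) =
          sin (y z) * (1 - cos φ) + (1 - cos (y z)) * sin φ := by
        rw [halfCot_pi_sub hyz]; field_simp; ring
      rw [e', s1, s2, c1, c2, sin_add]; ring
    rw [e]
    have t1 : 0 < sin (φ / 2) := sin_pos_of_pos_of_lt_pi (by linarith) (by linarith [hyz.1])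
    have t2 : 0 < sin (y z / 2) := sin_half_pos ⟨hyz.1, hyz.2.le⟩
    have t3 : 0 < sin (φ / 2 + y z / 2) :=
      sin_pos_of_pos_of_lt_pi (by linarith [hyz.1]) (by linarith)
    positivity
  rw [hcross]
  exact mul_pos (mul_pos hpos hr) (pos_of_mul_pos_right key hs.le)

theorem extAngle_circumscribedSeq (hr : 0 < r) (hy : ∀ i, y i ∈ Ioo 0 π) (i : ℕ) :
    extAngle (circumscribedSeq r y) i = y (i + 1) := by
  have hpos : ∀ i, 0 < r * (halfCot (π - y i) + halfCot (π - y (i + 1))) := fun i =>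
    mul_pos hr (add_pos (halfCot_pi_sub_pos (hy _)) (halfCot_pi_sub_pos (hy _)))
  rw [extAngle, circumscribedSeq_sub hy, circumscribedSeq_sub hy, turning_succ y (i + 1)]
  exact angle_smul_dirVec (hpos _) (hpos _) _ (hy _)

end circumscribedSeq

/-! ### Convex polygons and their vertex sequences -/

theorem sum_univ_eq_sum_range_mod {n : ℕ} (hn : 0 < n) (f : Fin n → ℝ) (j : ℕ) :
    ∑ i, f i = ∑ i ∈ Finset.range n, f ⟨(j + i) % n, Nat.mod_lt _ hn⟩ := by
  have : NeZero n := ⟨hn.ne'⟩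
  rw [← Fin.sum_univ_eq_sum_range fun i => f ⟨(j + i) % n, Nat.mod_lt _ hn⟩,
    ← Equiv.sum_comp (Equiv.addLeft (Fin.ofNat n j))]
  refine Finset.sum_congr rfl fun i _ => congrArg f (Fin.ext ?_)
  simp [Fin.val_add]

theorem finRotate_mk_mod {n : ℕ} (hn : 0 < n) (m : ℕ) :
    finRotate n ⟨m % n, Nat.mod_lt _ hn⟩ = ⟨(m + 1) % n, Nat.mod_lt _ hn⟩ := by
  have : NeZero n := ⟨hn.ne'⟩
  rw [finRotate_apply]
  apply Fin.ext
  simp [Fin.val_add]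

namespace ConvexPolygon

variable {n : ℕ}

theorem pos (P : ConvexPolygon n) : 0 < n := by have := P.three_le; omega

/-- The periodic sequence of the vertices, starting at the vertex with index `j`. -/
def seq (P : ConvexPolygon n) (j i : ℕ) : Plane := P.vertices ⟨(j + i) % n, Nat.mod_lt _ P.pos⟩

theorem finRotate_vertices (P : ConvexPolygon n) (j i : ℕ) :
    P.vertices (finRotate n ⟨(j + i) % n, Nat.mod_lt _ P.pos⟩) = P.seq j (i + 1) := by
  rw [finRotate_mk_mod P.pos]; rfl

theorem isConvexSeq_seq (P : ConvexPolygon n) (j : ℕ) : IsConvexSeq n (P.seq j) := by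
  refine ⟨P.three_le, fun i => ?_, fun i k h1 h2 => ?_⟩
  · simp only [seq, ← add_assoc, Nat.add_mod_right]
  · rw [← P.finRotate_vertices]
    apply P.convex
    · intro h
      exact h1 (Nat.ModEq.add_left_cancel' j (Fin.mk.inj_iff.1 h))
    · rw [finRotate_mk_mod P.pos]
      intro h
      exact h2 (Nat.ModEq.add_left_cancel' j (Fin.mk.inj_iff.1 h))

theorem perimeter_eq (P : ConvexPolygon n) (j : ℕ) : P.perimeter = seqPerimeter n (P.seq j) := by
  rw [perimeter, sum_univ_eq_sum_range_mod P.pos _ j, seqPerimeter]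
  refine Finset.sum_congr rfl fun i _ => ?_
  rw [P.finRotate_vertices, dist_comm, dist_eq_norm]
  rfl

theorem range_seq (P : ConvexPolygon n) (j : ℕ) : range (P.seq j) = range P.vertices := by
  apply Subset.antisymm
  · rintro _ ⟨i, rfl⟩; exact ⟨_, rfl⟩
  · rintro _ ⟨i, rfl⟩
    refine ⟨i + (n - j % n), congrArg P.vertices (Fin.ext ?_)⟩
    have h := Nat.mod_lt j P.pos
    have e : j + (i + (n - j % n)) = i + n * (j / n + 1) := by
      have h2 := Nat.div_add_mod j n
      rw [mul_add, mul_one]; omega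
    simp only [e, Nat.add_mul_mod_self_left]
    exact Nat.mod_eq_of_lt i.2

theorem region_eq (P : ConvexPolygon n) (j : ℕ) : P.region = convexHull ℝ (range (P.seq j)) := by
  rw [region, range_seq]

theorem area_eq (P : ConvexPolygon n) (j : ℕ) (c : Plane) :
    P.area = seqDoubleArea n (P.seq j) c / 2 := by
  rw [area, P.region_eq j, (P.isConvexSeq_seq j).volume_convexHull c]

/-- The exterior angle with index i lies between edges i and i + 1, hence at vertex i + 1 of the
sequence; this is the origin of the shift. -/
theorem interiorAngle_eq (P : ConvexPolygon n) (j i : ℕ) :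
    P.interiorAngle ⟨(j + 1 + i) % n, Nat.mod_lt _ P.pos⟩ = π - extAngle (P.seq j) i := by
  have e : (⟨(j + 1 + i) % n, Nat.mod_lt _ P.pos⟩ : Fin n) =
      finRotate n ⟨(j + i) % n, Nat.mod_lt _ P.pos⟩ := by
    rw [finRotate_mk_mod P.pos]; congr 2; ring
  have e1 : P.vertices (finRotate n (finRotate n ⟨(j + i) % n, Nat.mod_lt _ P.pos⟩)) =
      P.seq j (i + 1 + 1) := by
    rw [finRotate_mk_mod P.pos, finRotate_mk_mod P.pos]; rfl
  rw [interiorAngle, e, Equiv.symm_apply_apply, e1, P.finRotate_vertices,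
    EuclideanGeometry.angle, vsub_eq_sub, vsub_eq_sub, extAngle,
    show P.vertices ⟨(j + i) % n, Nat.mod_lt _ P.pos⟩ = P.seq j i from rfl,
    ← neg_sub (P.seq j (i + 1)) (P.seq j i), InnerProductGeometry.angle_neg_left]

theorem exists_index_eq (P : ConvexPolygon n) (k : Fin n) :
    ∃ i, k = ⟨(0 + 1 + i) % n, Nat.mod_lt _ P.pos⟩ := by
  refine ⟨k + (n - 1), Fin.ext ?_⟩
  have := P.pos
  simp only [show 0 + 1 + (↑k + (n - 1)) = k + n by omega, Nat.add_mod_right]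
  exact (Nat.mod_eq_of_lt k.2).symm

theorem interiorAngle_mem (P : ConvexPolygon n) (k : Fin n) : P.interiorAngle k ∈ Ioo 0 π := by
  obtain ⟨i, rfl⟩ := P.exists_index_eq k
  rw [interiorAngle_eq]
  have := (P.isConvexSeq_seq 0).extAngle_mem i
  exact ⟨by linarith [this.2], by linarith [this.1]⟩

theorem sum_interiorAngle (P : ConvexPolygon n) (g : ℝ → ℝ) (j : ℕ) :
    ∑ k, g (P.interiorAngle k) = ∑ i ∈ Finset.range n, g (π - extAngle (P.seq j) i) := by
  rw [sum_univ_eq_sum_range_mod P.pos _ (j + 1)]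
  exact Finset.sum_congr rfl fun i _ => by rw [interiorAngle_eq]

theorem sum_exterior (P : ConvexPolygon n) : ∑ k, (π - P.interiorAngle k) = 2 * π := by
  rw [P.sum_interiorAngle (fun t => π - t) 0, ← (P.isConvexSeq_seq 0).turning_eq_two_pi, turning]
  exact Finset.sum_congr rfl fun i _ => by ring

theorem sum_halfCot (P : ConvexPolygon n) (j : ℕ) :
    ∑ k, halfCot (P.interiorAngle k) = seqCotSum n (P.seq j) :=
  P.sum_interiorAngle halfCot j

theorem isCircumscriptible_iff (P : ConvexPolygon n) :
    P.IsCircumscriptible ↔ ∃ c r, 0 < r ∧ IsInscribed (P.seq 0) c r := by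
  have hi : ∀ i : Fin n, P.vertices i = P.seq 0 i ∧ P.vertices (finRotate n i) = P.seq 0 (i + 1) :=
    fun i => by
      have : i = ⟨(0 + i) % n, Nat.mod_lt _ P.pos⟩ := by
        apply Fin.ext; simp [Nat.mod_eq_of_lt i.2]
      refine ⟨congrArg P.vertices this, ?_⟩
      rw [← P.finRotate_vertices, ← this]
  constructor
  · rintro ⟨s, hs, h⟩
    have h' : ∀ i, ∃ p ∈ segment ℝ (P.seq 0 i) (P.seq 0 (i + 1)),
        s.IsTangentAt p (affineSpan ℝ {P.seq 0 i, P.seq 0 (i + 1)}) := by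
      intro i
      have := h ⟨(0 + i) % n, Nat.mod_lt _ P.pos⟩
      rwa [P.finRotate_vertices] at this
    choose p hp1 hp2 using h'
    exact ⟨_, _, hs, isInscribed_of_isTangentAt (P.isConvexSeq_seq 0) s hs hp1 hp2⟩
  · rintro ⟨c, r, hr, h⟩
    refine ⟨⟨c, r⟩, hr, fun i => ?_⟩
    rw [(hi i).1, (hi i).2]
    exact IsInscribed.exists_isTangentAt (P.isConvexSeq_seq 0) hr h i

theorem isInscribed_seq (P : ConvexPolygon n) {c : Plane} {r : ℝ} (h : IsInscribed (P.seq 0) c r)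
    (j : ℕ) : IsInscribed (P.seq j) c r := by
  intro i
  have := h (j + i)
  simpa only [seq, zero_add, add_assoc] using this

/-- The isoperimetric inequality for convex polygons with given angles. -/
theorem four_mul_area_mul_le (P : ConvexPolygon n) (hP : P.perimeter = 1) :
    4 * P.area * ∑ k, halfCot (P.interiorAngle k) ≤ 1 ∧
      (4 * P.area * ∑ k, halfCot (P.interiorAngle k) = 1 → P.IsCircumscriptible) := by
  have h := (P.isConvexSeq_seq 0).two_mul_doubleArea_mul_cotSum_le 0
  rw [← P.perimeter_eq, hP, one_pow] at h
  rw [P.area_eq 0 0, P.sum_halfCot 0, isCircumscriptible_iff,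
    show 4 * (seqDoubleArea n (P.seq 0) 0 / 2) = 2 * seqDoubleArea n (P.seq 0) 0 by ring]
  exact h

theorem two_mul_radius_mul (P : ConvexPolygon n) (hP : P.perimeter = 1) {c : Plane} {r : ℝ}
    (h : IsInscribed (P.seq 0) c r) : 2 * r * ∑ k, halfCot (P.interiorAngle k) = 1 := by
  rw [P.sum_halfCot 0, ← (P.isConvexSeq_seq 0).perimeter_of_isInscribed h, ← P.perimeter_eq, hP]

theorem four_mul_area_mul_eq (P : ConvexPolygon n) (hP : P.perimeter = 1)
    (h : P.IsCircumscriptible) : 4 * P.area * ∑ k, halfCot (P.interiorAngle k) = 1 := by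
  obtain ⟨c, r, -, hc⟩ := P.isCircumscriptible_iff.1 h
  rw [P.area_eq 0 c, hc.doubleArea_eq, ← P.perimeter_eq, hP]
  linear_combination P.two_mul_radius_mul hP hc

theorem sum_halfCot_pos (P : ConvexPolygon n) : 0 < ∑ k, halfCot (P.interiorAngle k) := by
  rw [P.sum_halfCot 0]; exact (P.isConvexSeq_seq 0).seqCotSum_pos

theorem angleSum_eq (P : ConvexPolygon n) : P.angleSum = ∑ k, angleTerm (P.interiorAngle k) := rfl

/-- There is a circumscriptible polygon of unit perimeter with given angles. -/
theorem exists_circumscriptible {w : Fin n → ℝ} (hw : ∀ i, w i ∈ Ioo 0 π)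
    (hsum : ∑ i, (π - w i) = 2 * π) : ∃ P : ConvexPolygon n, P.perimeter = 1 ∧
      P.IsCircumscriptible ∧ ∀ g : ℝ → ℝ, ∑ k, g (P.interiorAngle k) = ∑ i, g (w i) := by
  -- Exterior angles are below π, so at least three are needed for a sum of 2π.
  have hn : 3 ≤ n := by
    by_contra! hlt
    rcases Nat.eq_zero_or_pos n with rfl | h0
    · simp at hsum
    have h1 : ∑ i, (π - w i) < ∑ _i : Fin n, π :=
      Finset.sum_lt_sum_of_nonempty ⟨⟨0, h0⟩, Finset.mem_univ _⟩ fun i _ => by linarith [(hw i).1]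
    rw [hsum, Finset.sum_const, Finset.card_univ, Fintype.card_fin, nsmul_eq_mul] at h1
    have h2 : (n : ℝ) ≤ 2 := by exact_mod_cast Nat.le_of_lt_succ hlt
    have h3 := mul_le_mul_of_nonneg_right h2 pi_pos.le
    linarith
  have hn0 : 0 < n := by omega
  set y : ℕ → ℝ := fun i => π - w ⟨i % n, Nat.mod_lt _ hn0⟩ with hy
  have hyI : ∀ i, y i ∈ Ioo 0 π := fun i => by
    have := hw ⟨i % n, Nat.mod_lt _ hn0⟩
    exact ⟨sub_pos.2 this.2, by simp only [hy]; linarith [this.1]⟩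
  have hper : ∀ i, y (i + n) = y i := fun i => by simp only [hy, Nat.add_mod_right]
  have hturn : turning y n = 2 * π := by
    rw [← hsum, sum_univ_eq_sum_range_mod hn0 _ 0]
    simp only [turning, zero_add, hy]
  have hg : ∀ g : ℝ → ℝ, ∑ i ∈ Finset.range n, g (π - y (i + 1)) = ∑ i, g (w i) := by
    intro g
    rw [sum_univ_eq_sum_range_mod hn0 _ 1]
    refine Finset.sum_congr rfl fun i _ => ?_
    simp only [hy, sub_sub_cancel, add_comm i 1]
  set C := ∑ i, halfCot (w i) with hC
  have hC0 : 0 < C := by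
    refine Finset.sum_pos (fun i _ => ?_) ⟨⟨0, hn0⟩, Finset.mem_univ _⟩
    rw [← sub_sub_cancel π (w i)]
    exact halfCot_pi_sub_pos ⟨by linarith [(hw i).2], by linarith [(hw i).1]⟩
  -- The perimeter of the circumscribed polygon is 2 r C.
  set r := 1 / (2 * C) with hr
  have hr0 : 0 < r := by positivity
  set U := circumscribedSeq r y with hU
  have hconv : IsConvexSeq n U := isConvexSeq_circumscribedSeq hn hr0 hyI hper hturn
  have hperU : Function.Periodic U n := hconv.periodic
  have hrot : ∀ i : Fin n, U (finRotate n i) = U (i + 1) := by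
    intro i
    have : finRotate n i = ⟨(i + 1) % n, Nat.mod_lt _ hn0⟩ := by
      rw [← finRotate_mk_mod hn0]; congr 1; apply Fin.ext; exact (Nat.mod_eq_of_lt i.2).symm
    rw [this]; exact hperU.map_mod_nat _
  let P : ConvexPolygon n :=
    { vertices := fun i => U i
      three_le := hn
      convex := fun i k h1 h2 => by
        rw [hrot]
        have hmod : ∀ a : ℕ, (k : ℕ) ≡ a [MOD n] → k = ⟨a % n, Nat.mod_lt _ hn0⟩ := fun a h =>
          Fin.ext (by rw [← Nat.mod_eq_of_lt k.2]; exact h)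
        refine hconv.left i k (fun h => h1 ?_) (fun h => h2 ?_)
        · rw [hmod _ h]; apply Fin.ext; exact Nat.mod_eq_of_lt i.2
        · rw [hmod _ h, ← finRotate_mk_mod hn0]
          congr 1; apply Fin.ext; exact Nat.mod_eq_of_lt i.2 }
  have hseq : P.seq 0 = U := by
    funext i
    change U ((0 + i) % n) = U i
    rw [zero_add, hperU.map_mod_nat]
  have hins : IsInscribed (P.seq 0) 0 r := by
    rw [hseq]; exact isInscribed_circumscribedSeq hr0 hyI
  have hang : ∀ g : ℝ → ℝ, ∑ k, g (P.interiorAngle k) = ∑ i, g (w i) := by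
    intro g
    rw [P.sum_interiorAngle g 0, hseq, ← hg]
    exact Finset.sum_congr rfl fun i _ => by rw [hU, extAngle_circumscribedSeq hr0 hyI]
  refine ⟨P, ?_, P.isCircumscriptible_iff.2 ⟨0, r, hr0, hins⟩, hang⟩
  rw [P.perimeter_eq 0, (P.isConvexSeq_seq 0).perimeter_of_isInscribed hins, ← P.sum_halfCot,
    hang, ← hC, hr]
  field_simp

/-! ### Maximizers, semi-regular polygons and congruence -/

theorem isSemiRegular_of_isMaximizer {P : ConvexPolygon n} (hP : P.perimeter = 1)
    (h : P.IsMaximizer) : P.IsSemiRegular := by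
  obtain ⟨m, w, hw, -, hsum, hS, hle, heq⟩ :=
    exists_equalButOneLarger_le P.interiorAngle_mem P.sum_exterior
  obtain ⟨R, hR, hRc, hRw⟩ := exists_circumscriptible hw hsum
  -- With C the cotangent sums, 1 = 4|R| C(w) ≤ 4|P| C(w) ≤ 4|P| C(P) ≤ 1. Equality throughout makes
  -- P circumscriptible with minimising angles.
  have h1 : R.area ≤ P.area := h.2 m R hR (by rw [R.angleSum_eq, hRw, hS, P.angleSum_eq])
  have h2 := R.four_mul_area_mul_eq hR hRc
  obtain ⟨h3, h4⟩ := P.four_mul_area_mul_le hP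
  rw [hRw] at h2
  have hC : 0 < ∑ i, halfCot (w i) := by rw [← hRw]; exact R.sum_halfCot_pos
  have hA : 0 < P.area := by
    have : 0 < R.area := by
      by_contra! hcon
      have := mul_nonpos_of_nonpos_of_nonneg hcon hC.le
      linarith
    linarith
  have h5 : R.area * ∑ i, halfCot (w i) ≤ P.area * ∑ i, halfCot (w i) :=
    mul_le_mul_of_nonneg_right h1 hC.le
  have h6 : P.area * ∑ i, halfCot (w i) ≤ P.area * ∑ k, halfCot (P.interiorAngle k) :=
    mul_le_mul_of_nonneg_left hle hA.le
  refine ⟨h4 (by linarith), heq (mul_left_cancel₀ hA.ne' ?_)⟩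
  linarith

/-- The optimal family for a competitor Q has the same S and the same shape as the angles of P, so
by uniqueness C(P) ≤ C(Q). Then 4|Q| C(P) ≤ 4|Q| C(Q) ≤ 1 = 4|P| C(P). -/
theorem isMaximizer_of_isSemiRegular {P : ConvexPolygon n} (hP : P.perimeter = 1)
    (h : P.IsSemiRegular) : P.IsMaximizer := by
  refine ⟨hP, fun k Q hQ hS => ?_⟩
  obtain ⟨m, w, hw, ⟨l, β, hl, hβ⟩, hsum, hwS, hle, -⟩ :=
    exists_equalButOneLarger_le Q.interiorAngle_mem Q.sum_exterior
  obtain ⟨hc, j, α, hj, hα⟩ := h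
  -- R serves only to show that the family `w` has at least three angles.
  obtain ⟨R, -, -, -⟩ := exists_circumscriptible hw hsum
  have hm := R.three_le
  have hn := P.three_le
  obtain ⟨hnm, hαβ, hjl⟩ := equalButOneLarger_unique P.interiorAngle_mem hw (by omega) (by omega)
    hj hα hl hβ P.sum_exterior hsum (by rw [hwS]; exact hS.symm)
  have hcot : ∑ k, halfCot (P.interiorAngle k) = ∑ i, halfCot (w i) := by
    subst hnm
    obtain ⟨n, rfl⟩ : ∃ n', n = n' + 1 := ⟨n - 1, by omega⟩
    rw [sum_of_equalButOneLarger hj, sum_of_equalButOneLarger hl, hαβ, hjl]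
  have h1 := P.four_mul_area_mul_eq hP hc
  have h2 := (Q.four_mul_area_mul_le hQ).1
  rw [← hcot] at hle
  have hC := P.sum_halfCot_pos
  by_contra! hlt
  have hA : 0 < P.area := by
    by_contra! hcon
    have := mul_nonpos_of_nonpos_of_nonneg hcon hC.le
    linarith
  have h3 : P.area * ∑ k, halfCot (P.interiorAngle k) < Q.area * ∑ k, halfCot (P.interiorAngle k) :=
    mul_lt_mul_of_pos_right hlt hC
  have h4 : Q.area * ∑ k, halfCot (P.interiorAngle k) ≤ Q.area * ∑ k, halfCot (Q.interiorAngle k) :=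
    mul_le_mul_of_nonneg_left hle (hA.trans hlt).le
  linarith

/-- Equal S forces the same angles, and unit perimeter then the same inradius 1/(2C). Starting both
vertex sequences at the exceptional vertices makes the exterior angles agree index by index. -/
theorem isCongruent_of_angleSum_eq {m : ℕ} {P : ConvexPolygon n} {Q : ConvexPolygon m}
    (hP : P.perimeter = 1) (hQ : Q.perimeter = 1) (hPs : P.IsSemiRegular) (hQs : Q.IsSemiRegular)
    (hS : P.angleSum = Q.angleSum) : P.IsCongruent Q := by
  obtain ⟨hPc, j, α, hj, hα⟩ := hPs
  obtain ⟨hQc, k, β, hk, hβ⟩ := hQs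
  have hn := P.three_le
  have hm := Q.three_le
  obtain ⟨rfl, rfl, hjk⟩ := equalButOneLarger_unique P.interiorAngle_mem Q.interiorAngle_mem
    (by omega) (by omega) hj hα hk hβ P.sum_exterior Q.sum_exterior hS
  obtain ⟨c, r, hr, hc⟩ := P.isCircumscriptible_iff.1 hPc
  obtain ⟨c', r', hr', hc'⟩ := Q.isCircumscriptible_iff.1 hQc
  have hcot : ∑ k, halfCot (P.interiorAngle k) = ∑ k, halfCot (Q.interiorAngle k) := by
    obtain ⟨n, rfl⟩ : ∃ n', n = n' + 1 := ⟨n - 1, by omega⟩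
    rw [sum_of_equalButOneLarger hj, sum_of_equalButOneLarger hk, hjk]
  have hrr : r = r' := by
    have h1 := P.two_mul_radius_mul hP hc
    have h2 := Q.two_mul_radius_mul hQ hc'
    rw [hcot] at h1
    have := mul_right_cancel₀ Q.sum_halfCot_pos.ne' (h1.trans h2.symm)
    linarith
  subst hrr
  -- Exterior angle i of the sequence started at l belongs to the vertex l + 1 + i, so the
  -- exceptional one occurs exactly when n divides 1 + i, in both polygons alike.
  have hidx : ∀ (l : Fin n) (i : ℕ),
      (⟨(l + 1 + i) % n, Nat.mod_lt _ P.pos⟩ : Fin n) = l ↔ 1 + i ≡ 0 [MOD n] := by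
    intro l i
    rw [Fin.ext_iff, add_assoc]
    constructor
    · intro h
      refine Nat.ModEq.add_left_cancel' (l : ℕ) ?_
      rw [Nat.ModEq, add_zero, Nat.mod_eq_of_lt l.2]; exact h
    · intro h
      have := Nat.ModEq.add_left (l : ℕ) h
      rwa [Nat.ModEq, add_zero, Nat.mod_eq_of_lt l.2] at this
  have hext : ∀ i, extAngle (P.seq j) i = extAngle (Q.seq k) i := by
    intro i
    have h1 := P.interiorAngle_eq j i
    have h2 := Q.interiorAngle_eq k i
    have h3 : P.interiorAngle ⟨(j + 1 + i) % n, Nat.mod_lt _ P.pos⟩ =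
        Q.interiorAngle ⟨(k + 1 + i) % n, Nat.mod_lt _ Q.pos⟩ := by
      by_cases h : 1 + i ≡ 0 [MOD n]
      · rw [(hidx j i).2 h, (hidx k i).2 h, hjk]
      · rw [hj _ fun h' => h ((hidx j i).1 h'), hk _ fun h' => h ((hidx k i).1 h')]
    linarith
  obtain ⟨e, he⟩ := IsInscribed.exists_isometry (P.isConvexSeq_seq j) (Q.isConvexSeq_seq k) hext
    (P.isInscribed_seq hc j) (Q.isInscribed_seq hc' k)
  refine ⟨e, ?_⟩
  have haff : ∀ s : Set Plane, e '' convexHull ℝ s = convexHull ℝ (e '' s) := fun s =>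
    AffineMap.image_convexHull (e.toRealAffineIsometryEquiv.toAffineEquiv : Plane →ᵃ[ℝ] Plane) s
  rw [P.region_eq j, Q.region_eq k, haff, ← range_comp]
  congr 2
  funext i
  exact he i

end ConvexPolygon

end

theorem theorem2p1 :
    (∀ (n : ℕ) (P : ConvexPolygon n), P.perimeter = 1 →
      (P.IsMaximizer ↔ P.IsSemiRegular)) ∧
    (∀ (n m : ℕ) (P : ConvexPolygon n) (Q : ConvexPolygon m),
      P.perimeter = 1 → Q.perimeter = 1 → P.IsSemiRegular → Q.IsSemiRegular →
        ¬ P.IsCongruent Q → P.angleSum ≠ Q.angleSum) :=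
  ⟨fun _ _ hP => ⟨ConvexPolygon.isSemiRegular_of_isMaximizer hP,
    ConvexPolygon.isMaximizer_of_isSemiRegular hP⟩,
    fun _ _ _ _ hP hQ hPs hQs hc hS =>
      hc (ConvexPolygon.isCongruent_of_angleSum_eq hP hQ hPs hQs hS)⟩
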